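/- For a group $K$ generated by a finite set $S$, let $\gamma_{K,S}(n)$ be the number of elements of $K$ that are products of at most $n$ elements of $S\cup S^{-1}$; a finitely generated group $K$ has subexponential growth if $\lim_{n\to\infty}\gamma_{K,S}(n)^{1/n}=1$ for every finite generating set $S$ (equivalently, for one). A group has locally subexponential growth if all its finitely generated subgroups have subexponential growth. Let $\mathcal S$ be the class of groups $G$ that admit a finite chain of subgroups $$\{1\}=G^{n}\lhd G^{n-1}\lhd\cdots\lhd G^1\lhd G^0=G,$$ each normal in the preceding one $G^{i-1}$, such that $G^{i-1}/G^{i}$ has locally subexponential growth for every $i=1,\dots,n$. **Theorem A.** Every solvable group belongs to $\mathcal S$. Moreover, let $G$ be a group in $\mathcal S$ acting on $\mathbb R$ by order-preserving homeomorphisms, and suppose that some $T\in G$ has no fixed point in $\mathbb R$. Then there is a nonzero Radon measure $\mu$ on $\mathbb R$ (a Borel measure that is finite on compact sets) that is quasi-preserved by $G$: for every $g\in G$ there is a real number $\lambda_g>0$ such that $g_*\mu=\lambda_g\,\mu$, where $g_*\mu(B)=\mu(g^{-1}(B))$ for every Borel set $B$. -/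

import Mathlib

open Filter Topology MeasureTheory
open scoped Pointwise

/-- Growth function of `K` with respect to `S`: the number of elements of `K` that are products
of at most `n` elements of `S ∪ S⁻¹`. -/
noncomputable def growthFunction {K : Type*} [Group K] (S : Finset K) (n : ℕ) : ℕ :=
  ((insert 1 ((S : Set K) ∪ (S : Set K)⁻¹)) ^ n : Set K).ncard

/-- A finitely generated group has subexponential growth if its growth functions `γ` satisfy
`γ(n)^(1/n) → 1`. -/
def HasSubexponentialGrowth (K : Type*) [Group K] : Prop :=
  Group.FG K ∧ ∀ S : Finset K, Subgroup.closure (S : Set K) = ⊤ →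
    Tendsto (fun n : ℕ => (growthFunction S n : ℝ) ^ (1 / (n : ℝ))) atTop (𝓝 1)

/-- Every finitely generated subgroup has subexponential growth. -/
def HasLocallySubexponentialGrowth (K : Type*) [Group K] : Prop :=
  ∀ H : Subgroup K, H.FG → HasSubexponentialGrowth H

/-- The class `𝒮`: there is a finite chain `{1} = F n ⊴ ⋯ ⊴ F 1 ⊴ F 0 = G`, each term normal in
the preceding one, all of whose successive quotients have locally subexponential growth. -/
def InClassS (G : Type*) [Group G] : Prop :=
  ∃ (n : ℕ) (F : ℕ → Subgroup G), F 0 = ⊤ ∧ F n = ⊥ ∧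
    ∀ i < n, F (i + 1) ≤ F i ∧
      ∃ _ : ((F (i + 1)).subgroupOf (F i)).Normal,
        HasLocallySubexponentialGrowth (F i ⧸ (F (i + 1)).subgroupOf (F i))

/-- The action `ρ` quasi-preserves `μ`: for every `g` there is a real `c > 0` with `g_*μ = c μ`. -/
def QuasiPreserves {G : Type*} [Group G] (ρ : G →* (ℝ ≃ₜ ℝ)) (μ : Measure ℝ) : Prop :=
  ∀ g : G, ∃ c : ℝ, 0 < c ∧ μ.map (ρ g) = ENNReal.ofReal c • μ

/-! ### Fixed points of monotone actions on conditionally complete linear orders -/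

section OrderAction

variable {G X : Type*} [Group G] [MulAction G X]

/-! It suffices to find an affine developing map: a nonconstant monotone Φ such that every g
satisfies Φ(g x) = l Φ(x) + c with l > 0. Its Stieltjes measure is then quasi-preserved. Growth
enters only through `SubexpMod`: a pair of elements whose positive words of equal length are all
separated by the action yields 2^n classes, which is excluded.

The map is found by induction on the length of the chain, over all conditionally complete linear
orders X at once. Let N be the last term of the chain not assumed to act trivially. Ping-pong inside
N and an induction up the chain show that conjugates of elements of N are never crossed
(`IsSubexpChain.not_crossed`). In the presence of a fixed-point-free element, this forces the
conjugates that have fixed points to share one (`IsSubexpChain.exists_common_fixed`). The set Y of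
all common fixed points is G-invariant and conditionally complete, N acts semifreely on it, and a
developing map on Y extends to X.

By Hölder's theorem the action of N on Y is ordered by a homomorphism τ to ℝ. If τ has dense image,
the developing map of N is unique up to affine maps, and this uniqueness transfers equivariance up
the chain to G. If the image is cyclic and nonzero, the term above N commutes with N on Y, so the
two steps merge into one without spoiling growth (`IsSubexpChain.exists_shorter`); if N = G, its own
developing map suffices. If N acts trivially on Y, it is dropped.

Solvable groups lie in the class through the derived series, since abelian groups grow polynomially.
-/

theorem inv_smul_eq_self_iff {g : G} {x : X} : g⁻¹ • x = x ↔ g • x = x := by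
  rw [inv_smul_eq_iff, eq_comm]

theorem conj_smul_eq_self_iff {g f : G} {x : X} : (g * f * g⁻¹) • x = x ↔ f • g⁻¹ • x = g⁻¹ • x := by
  rw [mul_smul, mul_smul, smul_eq_iff_eq_inv_smul]

theorem pow_smul_eq_self {g : G} {x : X} (h : g • x = x) (n : ℕ) : g ^ n • x = x := by
  induction n with
  | zero => simp
  | succ n ih => rw [pow_succ, mul_smul, h, ih]

theorem pow_succ_smul_inv_smul (g : G) (n : ℕ) (x : X) : g ^ (n + 1) • g⁻¹ • x = g ^ n • x := by
  rw [pow_succ, mul_smul, smul_inv_smul]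

variable [ConditionallyCompleteLinearOrder X]

theorem smul_lt_smul_of_monotone (hm : ∀ g : G, Monotone fun x : X => g • x) (g : G) {x y : X}
    (h : x < y) : g • x < g • y :=
  ((hm g).strictMono_of_injective (MulAction.injective g)) h

theorem smul_lt_iff_of_monotone (hm : ∀ g : G, Monotone fun x : X => g • x) {g : G} {x y : X} :
    g • x < y ↔ x < g⁻¹ • y := by
  constructor
  · intro h
    simpa using smul_lt_smul_of_monotone hm g⁻¹ h
  · intro h
    simpa using smul_lt_smul_of_monotone hm g h

theorem lt_smul_iff_of_monotone (hm : ∀ g : G, Monotone fun x : X => g • x) {g : G} {x y : X} :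
    x < g • y ↔ g⁻¹ • x < y := by
  rw [smul_lt_iff_of_monotone hm, inv_inv]

/-- The supremum of a set that is, up to cofinality, invariant under `g`, is fixed by `g`. -/
theorem smul_csSup_eq_self (hm : ∀ g : G, Monotone fun x : X => g • x) {g : G} {s : Set X}
    (hne : s.Nonempty) (hb : BddAbove s) (h₁ : ∀ x ∈ s, g • x ∈ s)
    (h₂ : ∀ x ∈ s, ∃ y ∈ s, x ≤ g • y) : g • sSup s = sSup s := by
  apply le_antisymm
  · have : sSup s ≤ g⁻¹ • sSup s := csSup_le hne fun x hx => by
      simpa using hm g⁻¹ (le_csSup hb (h₁ x hx))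
    simpa using hm g this
  · refine csSup_le hne fun x hx => ?_
    obtain ⟨y, hy, hxy⟩ := h₂ x hx
    exact hxy.trans (hm g (le_csSup hb hy))

theorem monotone_smul_orderDual (hm : ∀ g : G, Monotone fun x : X => g • x) (g : G) :
    Monotone fun x : Xᵒᵈ => g • x :=
  fun _ _ h => hm g (OrderDual.ofDual_le_ofDual.2 h)

/-- The last fixed point of `g` before `x`. -/
theorem exists_last_fixed (hm : ∀ g : G, Monotone fun x : X => g • x) {g : G} {p x : X}
    (hp : g • p = p) (hpx : p ≤ x) :
    ∃ c, p ≤ c ∧ c ≤ x ∧ g • c = c ∧ ∀ y, c < y → y ≤ x → g • y ≠ y := by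
  have hb : BddAbove {y | y ≤ x ∧ g • y = y} := ⟨x, fun y hy => hy.1⟩
  refine ⟨sSup {y | y ≤ x ∧ g • y = y}, le_csSup hb ⟨hpx, hp⟩, csSup_le ⟨p, hpx, hp⟩ fun y hy => hy.1,
    smul_csSup_eq_self hm ⟨p, hpx, hp⟩ hb ?_ ?_, ?_⟩
  · intro y hy
    rwa [hy.2]
  · exact fun y hy => ⟨y, hy, hy.2.ge⟩
  · exact fun y hy hyx h => (le_csSup hb ⟨hyx, h⟩).not_gt hy

/-- The first fixed point of `g` after `x`. -/
theorem exists_first_fixed (hm : ∀ g : G, Monotone fun x : X => g • x) {g : G} {p x : X}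
    (hp : g • p = p) (hpx : x ≤ p) :
    ∃ b, x ≤ b ∧ b ≤ p ∧ g • b = b ∧ ∀ y, x ≤ y → y < b → g • y ≠ y := by
  obtain ⟨c, h1, h2, h3, h4⟩ := exists_last_fixed (X := Xᵒᵈ) (monotone_smul_orderDual hm)
    (p := OrderDual.toDual p) (x := OrderDual.toDual x) (g := g) hp hpx
  exact ⟨OrderDual.ofDual c, h2, h1, h3, fun y hy hyb => h4 (OrderDual.toDual y) hyb hy⟩

/-- Iterates of a point moved to the right get past every `y` before which there is no
fixed point. -/
theorem exists_lt_pow_smul (hm : ∀ g : G, Monotone fun x : X => g • x) {g : G} {x y : X}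
    (hx : x ≤ g • x) (hfree : ∀ z, x ≤ z → z ≤ y → g • z ≠ z) : ∃ n : ℕ, y < g ^ n • x := by
  by_contra! hcon
  have hb : BddAbove (Set.range fun n : ℕ => g ^ n • x) := ⟨y, by rintro _ ⟨n, rfl⟩; exact hcon n⟩
  have hne : (Set.range fun n : ℕ => g ^ n • x).Nonempty := Set.range_nonempty _
  refine hfree (sSup (Set.range fun n : ℕ => g ^ n • x)) (le_csSup hb ⟨0, by simp⟩)
    (csSup_le hne (by rintro _ ⟨n, rfl⟩; exact hcon n)) (smul_csSup_eq_self hm hne hb ?_ ?_)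
  · rintro _ ⟨n, rfl⟩
    exact ⟨n + 1, by simp only [pow_succ', mul_smul]⟩
  · rintro _ ⟨n, rfl⟩
    refine ⟨_, ⟨n, rfl⟩, ?_⟩
    simp only [← mul_smul, ← pow_succ']
    rw [pow_succ, mul_smul]
    exact hm _ hx

theorem exists_pow_smul_lt (hm : ∀ g : G, Monotone fun x : X => g • x) {g : G} {x y : X}
    (hx : g • x ≤ x) (hfree : ∀ z, z ≤ x → y ≤ z → g • z ≠ z) : ∃ n : ℕ, g ^ n • x < y :=
  exists_lt_pow_smul (X := Xᵒᵈ) (monotone_smul_orderDual hm) (x := OrderDual.toDual x)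
    (y := OrderDual.toDual y) (g := g) hx (fun z h1 h2 => hfree (OrderDual.ofDual z) h1 h2)

/-- A fixed-point-free element moves all points in the same direction. -/
theorem lt_smul_of_forall_ne (hm : ∀ g : G, Monotone fun x : X => g • x) {T : G}
    (hT : ∀ x : X, T • x ≠ x) {x₀ : X} (h₀ : x₀ < T • x₀) (x : X) : x < T • x := by
  by_contra! hx
  -- An intermediate value argument without continuity: between points moved in opposite directions,
  -- a supremum of points moved one way is fixed by T or T⁻¹.
  rcases le_total x₀ x with h | h
  · have hne : {y : X | y ≤ x ∧ y ≤ T • y}.Nonempty := ⟨x₀, h, h₀.le⟩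
    have hb : BddAbove {y : X | y ≤ x ∧ y ≤ T • y} := ⟨x, fun y hy => hy.1⟩
    refine hT _ (smul_csSup_eq_self hm hne hb ?_ fun y hy => ⟨y, hy, hy.2⟩)
    exact fun y hy => ⟨(hm T hy.1).trans hx, hm T hy.2⟩
  · have hne : {y : X | y ≤ x₀ ∧ T • y ≤ y}.Nonempty := ⟨x, h, hx⟩
    have hb : BddAbove {y : X | y ≤ x₀ ∧ T • y ≤ y} := ⟨x₀, fun y hy => hy.1⟩
    have key := smul_csSup_eq_self hm (g := T⁻¹) hne hb ?_ ?_
    · exact hT _ (inv_smul_eq_self_iff.1 key)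
    · refine fun y hy => ⟨(hm T⁻¹ hy.1).trans ?_, ?_⟩
      · simpa using hm T⁻¹ h₀.le
      · simpa using hm T⁻¹ hy.2
    · refine fun y hy => ⟨y, hy, ?_⟩
      simpa using hm T⁻¹ hy.2

/-- A fixed-point-free element or its inverse moves all points to the right. -/
theorem exists_forall_lt_smul (hm : ∀ g : G, Monotone fun x : X => g • x) {T : G}
    (hT : ∀ x : X, T • x ≠ x) : (∀ x : X, x < T • x) ∨ ∀ x : X, x < T⁻¹ • x := by
  -- The value of `sSup ∅` is irrelevant; it only provides a point of X.
  have x₀ : X := sSup ∅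
  rcases lt_or_gt_of_ne (hT x₀) with h | h
  · right
    refine lt_smul_of_forall_ne hm (fun x => ?_) (x₀ := x₀) ((smul_lt_iff_of_monotone hm).1 h)
    exact fun h => hT x (inv_smul_eq_self_iff.1 h)
  · exact Or.inl (lt_smul_of_forall_ne hm hT h)

end OrderAction

/-! ### Growth, separated words and subexponential chains -/

section Growth

variable {G : Type*} [Group G]

/-- For all `a b ∈ P`, the number of classes modulo `Q` of products of `n` factors `a` or `b`
grows subexponentially in `n`. -/
def SubexpMod (P Q : Subgroup G) : Prop :=
  ∀ a ∈ P, ∀ b ∈ P, ∀ c : ℝ, 1 < c →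
    ∀ᶠ n : ℕ in atTop,
      ((QuotientGroup.mk '' (({a, b} : Set G) ^ n) : Set (G ⧸ Q)).ncard : ℝ) ≤ c ^ n

theorem Set.Finite.pow_nat {s : Set G} (hs : s.Finite) (n : ℕ) : (s ^ n).Finite := by
  induction n with
  | zero => simp
  | succ n ih => rw [pow_succ]; exact ih.mul hs

theorem finite_pair_pow (a b : G) (n : ℕ) : (({a, b} : Set G) ^ n).Finite :=
  Set.Finite.pow_nat (Set.toFinite _) n

/-- If, for each `n`, some point separates the products of length `n + 1` beginning with `a` from
those beginning with `b`, then there are `2 ^ n` products of length `n`. -/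
theorem two_pow_le_ncard {X : Type*} [MulAction G X] {Q : Subgroup G}
    (hQ : ∀ g ∈ Q, ∀ x : X, g • x = x) {a b : G}
    (hab : ∀ n : ℕ, ∃ x : X, ∀ u ∈ ({a, b} : Set G) ^ n, ∀ v ∈ ({a, b} : Set G) ^ n,
      a • u • x ≠ b • v • x) (n : ℕ) :
    2 ^ n ≤ (QuotientGroup.mk '' (({a, b} : Set G) ^ n) : Set (G ⧸ Q)).ncard := by
  induction n with
  | zero => simp
  | succ n ih =>
    set W : Set (G ⧸ Q) := QuotientGroup.mk '' (({a, b} : Set G) ^ n) with hW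
    have hfin : W.Finite := (finite_pair_pow a b n).image _
    have hsplit : (QuotientGroup.mk '' (({a, b} : Set G) ^ (n + 1)) : Set (G ⧸ Q)) =
        (a • W) ∪ (b • W) := by
      ext y
      simp only [pow_succ', Set.mem_image, Set.mem_mul, Set.mem_union, Set.mem_smul_set, hW,
        Set.mem_insert_iff, Set.mem_singleton_iff]
      constructor
      · rintro ⟨_, ⟨c, rfl | rfl, u, hu, rfl⟩, rfl⟩
        · exact Or.inl ⟨_, ⟨u, hu, rfl⟩, rfl⟩
        · exact Or.inr ⟨_, ⟨u, hu, rfl⟩, rfl⟩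
      · rintro (⟨_, ⟨u, hu, rfl⟩, rfl⟩ | ⟨_, ⟨u, hu, rfl⟩, rfl⟩)
        · exact ⟨_, ⟨a, Or.inl rfl, u, hu, rfl⟩, rfl⟩
        · exact ⟨_, ⟨b, Or.inr rfl, u, hu, rfl⟩, rfl⟩
    -- Q acts trivially, so words in the same class have the same effect on the separating point.
    have hdisj : Disjoint (a • W) (b • W) := by
      rw [Set.disjoint_left]
      rintro _ ⟨_, ⟨u, hu, rfl⟩, rfl⟩ ⟨_, ⟨v, hv, rfl⟩, h⟩
      obtain ⟨x, hx⟩ := hab n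
      have h' : (QuotientGroup.mk (b * v) : G ⧸ Q) = QuotientGroup.mk (a * u) := h
      rw [QuotientGroup.eq] at h'
      have h'' := hQ _ h' x
      rw [mul_smul, inv_smul_eq_iff, mul_smul, mul_smul] at h''
      exact hx u hu v hv h''
    rw [hsplit, Set.ncard_union_eq hdisj (hfin.smul_set) (hfin.smul_set), Set.ncard_smul_set,
      Set.ncard_smul_set, pow_succ]
    omega

/-- Subexponential growth excludes pairs all of whose products of equal length are separated by
the action. -/
theorem SubexpMod.not_separated {X : Type*} [MulAction G X] {P Q : Subgroup G}
    (hPQ : SubexpMod P Q) (hQ : ∀ g ∈ Q, ∀ x : X, g • x = x) {a b : G} (ha : a ∈ P) (hb : b ∈ P)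
    (hab : ∀ n : ℕ, ∃ x : X, ∀ u ∈ ({a, b} : Set G) ^ n, ∀ v ∈ ({a, b} : Set G) ^ n,
      a • u • x ≠ b • v • x) : False := by
  -- Any rate strictly between 1 and 2 would do.
  obtain ⟨n, h1, h2⟩ := ((hPQ a ha b hb (3 / 2) (by norm_num)).and (eventually_gt_atTop 0)).exists
  have h3 : ((2 : ℝ)) ^ n ≤ (3 / 2) ^ n := le_trans (by exact_mod_cast two_pow_le_ncard hQ hab n) h1
  exact h3.not_gt (pow_lt_pow_left₀ (by norm_num) (by norm_num) h2.ne')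

/-- Ping-pong: two elements mapping a nonempty set into disjoint subsets of itself. -/
theorem SubexpMod.not_pingpong {X : Type*} [MulAction G X] {P Q : Subgroup G}
    (hPQ : SubexpMod P Q) (hQ : ∀ g ∈ Q, ∀ x : X, g • x = x) {a b : G} (ha : a ∈ P) (hb : b ∈ P)
    {J : Set X} (hJ : J.Nonempty) (haJ : ∀ x ∈ J, a • x ∈ J) (hbJ : ∀ x ∈ J, b • x ∈ J)
    (hdisj : ∀ x ∈ J, ∀ y ∈ J, a • x ≠ b • y) : False := by
  have hw : ∀ n : ℕ, ∀ u ∈ ({a, b} : Set G) ^ n, ∀ x ∈ J, u • x ∈ J := by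
    intro n
    induction n with
    | zero => simp
    | succ n ih =>
      intro u hu x hx
      rw [pow_succ', Set.mem_mul] at hu
      obtain ⟨c, hc, v, hv, rfl⟩ := hu
      rw [mul_smul]
      rcases hc with rfl | rfl
      · exact haJ _ (ih v hv x hx)
      · exact hbJ _ (ih v hv x hx)
  obtain ⟨x, hx⟩ := hJ
  exact hPQ.not_separated hQ ha hb fun n =>
    ⟨x, fun u hu v hv => hdisj _ (hw n u hu x hx) _ (hw n v hv x hx)⟩

/-- An element fixing the forward `h`-orbit of `h • q` fixes `q`. -/
theorem SubexpMod.fixed_of_fixed_forward {X : Type*} [MulAction G X] {P Q : Subgroup G}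
    (hPQ : SubexpMod P Q) (hQ : ∀ g ∈ Q, ∀ x : X, g • x = x) {h k : G} (hh : h ∈ P) (hk : k ∈ P)
    {q : X} (hfix : ∀ n : ℕ, k • h ^ (n + 1) • q = h ^ (n + 1) • q) : k • q = q := by
  by_contra hq
  -- As k fixes the orbit points passed, both letters act on them as h⁻¹, and every word of length n
  -- leads to h • q. One more letter then gives q or k • q, which separates the words.
  have hw : ∀ n : ℕ, ∀ u ∈ ({h⁻¹, k * h⁻¹} : Set G) ^ n, u • h ^ (n + 1) • q = h • q := by
    intro n
    induction n with
    | zero => simp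
    | succ n ih =>
      intro u hu
      rw [pow_succ, Set.mem_mul] at hu
      obtain ⟨v, hv, c, hc, rfl⟩ := hu
      rw [mul_smul]
      have hinv : h⁻¹ • h ^ (n + 1 + 1) • q = h ^ (n + 1) • q := by
        rw [pow_succ' h (n + 1), mul_smul, inv_smul_smul]
      rcases hc with rfl | rfl
      · rw [hinv, ih v hv]
      · rw [mul_smul, hinv, hfix, ih v hv]
  refine hPQ.not_separated (a := h⁻¹) (b := k * h⁻¹) hQ (P.inv_mem hh)
    (P.mul_mem hk (P.inv_mem hh)) fun n => ⟨h ^ (n + 1) • q, fun u hu v hv => ?_⟩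
  rw [hw n u hu, hw n v hv, mul_smul, inv_smul_smul]
  exact fun h => hq h.symm

/-- A descending chain of length `n`, each term normal in the preceding one, with successive
quotients of locally subexponential growth. -/
structure IsSubexpChain (F : ℕ → Subgroup G) (n : ℕ) : Prop where
  zero : F 0 = ⊤
  le : ∀ i < n, F (i + 1) ≤ F i
  conj_mem : ∀ i < n, ∀ g ∈ F i, ∀ x ∈ F (i + 1), g * x * g⁻¹ ∈ F (i + 1)
  subexp : ∀ i < n, SubexpMod (F i) (F (i + 1))

theorem IsSubexpChain.le_of_le {F : ℕ → Subgroup G} {n : ℕ} (hF : IsSubexpChain F n) {i j : ℕ}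
    (hij : i ≤ j) (hj : j ≤ n) : F j ≤ F i := by
  induction j, hij using Nat.le_induction with
  | base => exact le_rfl
  | succ j _ ih => exact (hF.le j (by omega)).trans (ih (by omega))

theorem IsSubexpChain.mono {F : ℕ → Subgroup G} {n m : ℕ} (hF : IsSubexpChain F n) (hm : m ≤ n) :
    IsSubexpChain F m where
  zero := hF.zero
  le i hi := hF.le i (by omega)
  conj_mem i hi := hF.conj_mem i (by omega)
  subexp i hi := hF.subexp i (by omega)

/-- An element of the bottom of a chain has the property of
`SubexpMod.fixed_of_fixed_forward` relative to the whole group. -/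
theorem IsSubexpChain.fixed_of_fixed_forward {X : Type*} [MulAction G X] {F : ℕ → Subgroup G}
    {m : ℕ} (hF : IsSubexpChain F (m + 1)) (htriv : ∀ g ∈ F (m + 1), ∀ x : X, g • x = x)
    {h : G} (hh : h ∈ F m) {k : G} {q : X}
    (hfix : ∀ n : ℕ, k • h ^ (n + 1) • q = h ^ (n + 1) • q) : k • q = q := by
  have key : ∀ j ≤ m, ∀ k ∈ F j, ∀ q : X,
      (∀ n : ℕ, k • h ^ (n + 1) • q = h ^ (n + 1) • q) → k • q = q := by
    intro j hj
    induction hj using Nat.decreasingInduction with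
    | self => exact fun k hk q => (hF.subexp m (by omega)).fixed_of_fixed_forward htriv hh hk
    | of_succ j hj ih =>
      intro k hk q hfix
      -- The commutator lies one step lower in the chain and fixes the forward orbit of h • q,
      -- excluding h • q itself. By induction it fixes h • q, and cancelling h gives k • q = q.
      have hmem : h * k * h⁻¹ * k⁻¹ ∈ F (j + 1) := by
        have h1 : h ∈ F (j + 1) := hF.le_of_le (by omega) (by omega) hh
        have := (F (j + 1)).mul_mem h1 (hF.conj_mem j (by omega) k hk _ ((F (j + 1)).inv_mem h1))
        simpa [mul_assoc] using this
      have hq := ih _ hmem (h • q) fun n => by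
        have e1 : h ^ (n + 1) • h • q = h ^ (n + 1 + 1) • q := by rw [pow_succ h (n + 1), mul_smul]
        rw [e1, mul_smul, inv_smul_eq_self_iff.2 (hfix (n + 1)), mul_smul, mul_smul,
          pow_succ' h (n + 1), mul_smul, inv_smul_smul, hfix n]
      have hq1 : k⁻¹ • h • q = h • q := inv_smul_eq_self_iff.2 (by simpa using hfix 0)
      rw [mul_smul, hq1, mul_smul, mul_smul, inv_smul_smul] at hq
      exact smul_left_cancel h hq
  exact key 0 (Nat.zero_le _) k (hF.zero ▸ Subgroup.mem_top k) q hfix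

/-- The bottom of the chain need not be normal in G, so its conjugates are treated separately, by
moving k and q with g⁻¹. -/
theorem IsSubexpChain.fixed_of_fixed_forward_conj {X : Type*} [MulAction G X]
    {F : ℕ → Subgroup G} {m : ℕ} (hF : IsSubexpChain F (m + 1))
    (htriv : ∀ g ∈ F (m + 1), ∀ x : X, g • x = x) {g h : G} (hh : h ∈ F m) {k : G} {q : X}
    (hfix : ∀ n : ℕ, k • (g * h * g⁻¹) ^ (n + 1) • q = (g * h * g⁻¹) ^ (n + 1) • q) :
    k • q = q := by
  have := hF.fixed_of_fixed_forward htriv hh (k := g⁻¹ * k * g) (q := g⁻¹ • q) fun n => by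
    have h1 := hfix n
    rw [conj_pow, mul_smul, mul_smul] at h1
    rw [mul_smul, mul_smul, h1, inv_smul_smul]
  rw [mul_smul, mul_smul, smul_inv_smul] at this
  exact smul_left_cancel _ this

end Growth

/-! ### Crossed elements and common fixed points -/

section Crossing

variable {G : Type*} [Group G]

/-- `f` fixes the right end and `k` the left end of an interval in which they have no other
fixed point. -/
def Crossed (X : Type*) [LinearOrder X] [MulAction G X] (f k : G) : Prop :=
  ∃ c b : X, c < b ∧ f • b = b ∧ k • c = c ∧ (∀ x, c ≤ x → x < b → f • x ≠ x) ∧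
    ∀ x, c < x → x ≤ b → k • x ≠ x

variable {X : Type*} [ConditionallyCompleteLinearOrder X] [MulAction G X]

theorem Crossed.conj (hm : ∀ g : G, Monotone fun x : X => g • x) {f k : G} (h : Crossed X f k)
    (g : G) : Crossed X (g * f * g⁻¹) (g * k * g⁻¹) := by
  obtain ⟨c, b, hcb, hf, hk, hf', hk'⟩ := h
  refine ⟨g • c, g • b, smul_lt_smul_of_monotone hm g hcb, ?_, ?_, ?_, ?_⟩
  · rwa [conj_smul_eq_self_iff, inv_smul_smul]
  · rwa [conj_smul_eq_self_iff, inv_smul_smul]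
  · intro x h1 h2
    rw [Ne, conj_smul_eq_self_iff]
    exact hf' _ (by simpa using hm g⁻¹ h1) ((lt_smul_iff_of_monotone hm).1 h2)
  · intro x h1 h2
    rw [Ne, conj_smul_eq_self_iff]
    exact hk' _ ((smul_lt_iff_of_monotone hm).1 h1) (by simpa using hm g⁻¹ h2)

/-- After possible inversion, f moves c to the right and k moves b to the left. Some k^n squeezes
[c, b] into [c, f • c), while f * k^n sends it into [f • c, b]: this is ping-pong. -/
theorem SubexpMod.not_crossed (hm : ∀ g : G, Monotone fun x : X => g • x) {P Q : Subgroup G}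
    (hPQ : SubexpMod P Q) (hQ : ∀ g ∈ Q, ∀ x : X, g • x = x) {f k : G} (hf : f ∈ P) (hk : k ∈ P) :
    ¬ Crossed X f k := by
  rintro ⟨c, b, hcb, hfb, hkc, hfree, hkfree⟩
  wlog hfc : c < f • c generalizing f
  · refine this (P.inv_mem hf) (inv_smul_eq_self_iff.2 hfb)
      (fun x h1 h2 h => hfree x h1 h2 (inv_smul_eq_self_iff.1 h)) ?_
    exact (smul_lt_iff_of_monotone hm).1 (lt_of_le_of_ne (not_lt.1 hfc) (hfree c le_rfl hcb))
  wlog hkb : k • b < b generalizing k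
  · refine this (P.inv_mem hk) (inv_smul_eq_self_iff.2 hkc)
      (fun x h1 h2 h => hkfree x h1 h2 (inv_smul_eq_self_iff.1 h)) ?_
    rw [smul_lt_iff_of_monotone hm, inv_inv]
    exact lt_of_le_of_ne (not_lt.1 hkb) (hkfree b hcb le_rfl).symm
  obtain ⟨n, hn⟩ := exists_pow_smul_lt hm (y := f • c) hkb.le
    (fun z hz hz' => hkfree z (hfc.trans_le hz') hz)
  have hknc : k ^ n • c = c := pow_smul_eq_self hkc n
  have hA : ∀ x ∈ Set.Icc c b, c ≤ k ^ n • x ∧ k ^ n • x < f • c := fun x hx =>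
    ⟨hknc.symm.le.trans (hm (k ^ n) hx.1), (hm (k ^ n) hx.2).trans_lt hn⟩
  have hfcb : f • c < b := by simpa [hfb] using smul_lt_smul_of_monotone hm f hcb
  refine hPQ.not_pingpong hQ (a := k ^ n) (b := f * k ^ n) (J := Set.Icc c b) (P.pow_mem hk n)
    (P.mul_mem hf (P.pow_mem hk n)) ⟨c, le_rfl, hcb.le⟩ (fun x hx => ?_) (fun x hx => ?_) ?_
  · exact ⟨(hA x hx).1, ((hA x hx).2.trans hfcb).le⟩
  · rw [mul_smul]
    refine ⟨hfc.le.trans (hm f (hA x hx).1), ?_⟩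
    simpa [hfb] using hm f ((hA x hx).2.trans hfcb).le
  · intro x hx y hy
    rw [mul_smul]
    exact ((hA x hx).2.trans_le (hm f (hA y hy).1)).ne

/-- Conjugates of elements of the bottom of a chain are never crossed. -/
theorem IsSubexpChain.not_crossed (hm : ∀ g : G, Monotone fun x : X => g • x)
    {F : ℕ → Subgroup G} {m : ℕ} (hF : IsSubexpChain F (m + 1))
    (htriv : ∀ g ∈ F (m + 1), ∀ x : X, g • x = x) {f k : G} (hf : f ∈ F m) (hk : k ∈ F m) (g : G) :
    ¬ Crossed X f (g * k * g⁻¹) := by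
  have key : ∀ j ≤ m, ∀ g ∈ F j, ∀ f ∈ F m, ∀ k ∈ F m, ¬ Crossed X f (g * k * g⁻¹) := by
    intro j hj
    induction hj using Nat.decreasingInduction with
    | self =>
      exact fun g hg f hf k hk => (hF.subexp m (by omega)).not_crossed hm htriv hf
        ((F m).mul_mem ((F m).mul_mem hg hk) ((F m).inv_mem hg))
    | of_succ j hj ih =>
      rintro g hg f hf k hk ⟨c, b, hcb, hfb, hkc, hfree, hkfree⟩
      wlog hkb : b < (g * k * g⁻¹) • b generalizing k
      · refine this k⁻¹ ((F m).inv_mem hk) ?_ ?_ ?_ <;> rw [← conj_inv]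
        · exact inv_smul_eq_self_iff.2 hkc
        · exact fun x h1 h2 h => hkfree x h1 h2 (inv_smul_eq_self_iff.1 h)
        · exact (smul_lt_iff_of_monotone hm).1
            (lt_of_le_of_ne (not_lt.1 hkb) (hkfree b hcb le_rfl))
      set k' := g * k * g⁻¹ with hk'
      have hk'mem : k' ∈ F (j + 1) :=
        hF.conj_mem j (by omega) g hg k (hF.le_of_le (by omega) (by omega) hk)
      -- Otherwise f would be crossed with its conjugate by k' ^ n between its last fixed point
      -- before k' ^ n • b and that point. As k' lies in F (j + 1), the induction excludes this.
      have hfix : ∀ n : ℕ, f • k' ^ n • b = k' ^ n • b := by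
        intro n
        by_contra hne
        have hbn : b ≤ k' ^ n • b := by
          clear hne
          induction n with
          | zero => simp
          | succ n ihn =>
            rw [pow_succ', mul_smul]
            exact hkb.le.trans (hm k' ihn)
        obtain ⟨c', hbc', hc'n, hfc', hfree'⟩ := exists_last_fixed hm hfb hbn
        have hlt : c' < k' ^ n • b := lt_of_le_of_ne hc'n fun h => hne (h ▸ hfc')
        have hcr : Crossed X (k' ^ n * f * (k' ^ n)⁻¹) f := by
          refine ⟨c', k' ^ n • b, hlt, ?_, hfc', ?_, hfree'⟩
          · rwa [conj_smul_eq_self_iff, inv_smul_smul]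
          · intro x h1 h2
            rw [Ne, conj_smul_eq_self_iff]
            refine hfree _ ?_ ((lt_smul_iff_of_monotone hm).1 h2)
            have := hm (k' ^ n)⁻¹ (hcb.le.trans (hbc'.trans h1))
            simpa [inv_smul_eq_self_iff.2 (pow_smul_eq_self hkc n)] using this
        have hcr' := hcr.conj hm (k' ^ n)⁻¹
        refine ih (k' ^ n)⁻¹ ((F (j + 1)).inv_mem ((F (j + 1)).pow_mem hk'mem n)) f hf f hf ?_
        convert! hcr' using 1
        group
      -- Being fixed along the forward orbit extends one step back, to a point of (c, b), where f
      -- has no fixed point.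
      have hlast : f • k'⁻¹ • b = k'⁻¹ • b := by
        refine hF.fixed_of_fixed_forward_conj htriv hk (g := g) fun n => ?_
        rw [← hk', pow_succ_smul_inv_smul]
        exact hfix n
      refine hfree _ ?_ (by rw [smul_lt_iff_of_monotone hm, inv_inv]; exact hkb) hlast
      simpa [inv_smul_eq_self_iff.2 hkc] using hm k'⁻¹ hcb.le
  exact key 0 (Nat.zero_le _) g (hF.zero ▸ Subgroup.mem_top g) f hf k hk

/-- The conjugates of elements of `N`. -/
def conjugatesIn (N : Subgroup G) : Set G := {f | ∃ g : G, ∃ k ∈ N, f = g * k * g⁻¹}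

theorem conj_mem_conjugatesIn {N : Subgroup G} {f : G} (hf : f ∈ conjugatesIn N) (g : G) :
    g * f * g⁻¹ ∈ conjugatesIn N := by
  obtain ⟨g', k, hk, rfl⟩ := hf
  exact ⟨g * g', k, hk, by group⟩

theorem inv_mem_conjugatesIn {N : Subgroup G} {f : G} (hf : f ∈ conjugatesIn N) :
    f⁻¹ ∈ conjugatesIn N := by
  obtain ⟨g', k, hk, rfl⟩ := hf
  exact ⟨g', k⁻¹, N.inv_mem hk, by group⟩

theorem IsSubexpChain.not_crossed_conjugatesIn (hm : ∀ g : G, Monotone fun x : X => g • x)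
    {F : ℕ → Subgroup G} {m : ℕ} (hF : IsSubexpChain F (m + 1))
    (htriv : ∀ g ∈ F (m + 1), ∀ x : X, g • x = x) {f k : G} (hf : f ∈ conjugatesIn (F m))
    (hk : k ∈ conjugatesIn (F m)) : ¬ Crossed X f k := by
  obtain ⟨g, f, hf, rfl⟩ := hf
  obtain ⟨g', k, hk, rfl⟩ := hk
  intro h
  have h1 := h.conj hm g⁻¹
  refine hF.not_crossed hm htriv hf hk (g⁻¹ * g') ?_
  convert! h1 using 1 <;> group

/-- A conjugate of an element of the bottom of a chain with a fixed point to the left of `x` has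
a fixed point in `[x, T • x]`. -/
theorem IsSubexpChain.exists_fixed_of_fixed_lt (hm : ∀ g : G, Monotone fun x : X => g • x)
    {F : ℕ → Subgroup G} {m : ℕ} (hF : IsSubexpChain F (m + 1))
    (htriv : ∀ g ∈ F (m + 1), ∀ x : X, g • x = x) {T : G} (hT : ∀ x : X, x < T • x)
    {f : G} (hf : f ∈ conjugatesIn (F m)) {p x : X} (hp : f • p = p) (hpx : p < x) :
    ∃ y, x ≤ y ∧ y ≤ T • x ∧ f • y = y := by
  by_contra! hfree
  obtain ⟨a, -, hax, hfa, hafree⟩ := exists_last_fixed hm hp hpx.le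
  have hax' : a < x := lt_of_le_of_ne hax fun h => hfree a h.ge (h ▸ (hT a).le) hfa
  have hafree' : ∀ y, a < y → y ≤ T • x → f • y ≠ y := fun y h1 h2 =>
    (le_total y x).elim (hafree y h1) (fun h => hfree y h h2)
  have hTax : T • a < T • x := smul_lt_smul_of_monotone hm T hax'
  have hf' : T * f * T⁻¹ ∈ conjugatesIn (F m) := conj_mem_conjugatesIn hf T
  have hf'a : (T * f * T⁻¹) • T • a = T • a := by rwa [conj_smul_eq_self_iff, inv_smul_smul]
  -- If f has a fixed point on the right, it is crossed with T * f * T⁻¹. If not, both are free to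
  -- the right of T • a, and the argument of orbits extended backwards applies.
  by_cases hr : ∃ z, T • x ≤ z ∧ f • z = z
  · obtain ⟨z, hz, hfz⟩ := hr
    obtain ⟨b, hxb, -, hfb, hbfree⟩ := exists_first_fixed hm hfz hz
    have hab : ∀ y, a < y → y < b → f • y ≠ y := fun y h1 h2 =>
      (le_total y (T • x)).elim (hafree' y h1) (fun h => hbfree y h h2)
    refine hF.not_crossed_conjugatesIn hm htriv hf hf' ⟨T • a, b, hTax.trans_le hxb, hfb, hf'a,
      fun y h1 h2 => hab y ((hT a).trans_le h1) h2, fun y h1 h2 => ?_⟩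
    rw [Ne, conj_smul_eq_self_iff]
    refine hab _ ((smul_lt_iff_of_monotone hm).1 h1) ?_
    rw [smul_lt_iff_of_monotone hm, inv_inv]
    exact h2.trans_lt (hT b)
  · push Not at hr
    have hab : ∀ y, a < y → f • y ≠ y := fun y h1 =>
      (le_total y (T • x)).elim (hafree' y h1) (fun h => hr y h)
    clear hfree hafree hafree' hr hp hpx hTax hax hax'
    have hne : f • T • a ≠ T • a := hab _ (hT a)
    have hab' : ∀ y, T • a < y → (T * f * T⁻¹) • y ≠ y := fun y hy => by
      rw [Ne, conj_smul_eq_self_iff]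
      exact hab _ ((smul_lt_iff_of_monotone hm).1 hy)
    set f' := T * f * T⁻¹
    -- `h` is the one of `f`, `f⁻¹` that moves `T • a` to the left
    obtain ⟨h, hh, hlt⟩ : ∃ h ∈ conjugatesIn (F m), h • T • a < T • a := by
      rcases lt_or_gt_of_ne hne with h | h
      · exact ⟨f, hf, h⟩
      · exact ⟨f⁻¹, inv_mem_conjugatesIn hf,
          by rwa [smul_lt_iff_of_monotone hm, inv_inv]⟩
    -- If this failed, f' and its conjugate by h ^ n would be crossed between h ^ n • T • a and the
    -- next fixed point of f'.
    have hfix : ∀ n : ℕ, f' • h ^ n • T • a = h ^ n • T • a := by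
      intro n
      by_contra hn
      have hle : h ^ n • T • a ≤ T • a := by
        clear hn
        induction n with
        | zero => simp
        | succ n ih =>
          rw [pow_succ', mul_smul]
          exact (hm h ih).trans hlt.le
      obtain ⟨d, hd1, hd2, hd3, hd4⟩ := exists_first_fixed hm hf'a hle
      have hlt' : h ^ n • T • a < d := lt_of_le_of_ne hd1 fun h => hn (by rwa [← h] at hd3)
      refine hF.not_crossed_conjugatesIn hm htriv hf' (conj_mem_conjugatesIn hf' (h ^ n))
        ⟨h ^ n • T • a, d, hlt', hd3, ?_, hd4, fun y h1 _ => ?_⟩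
      · rwa [conj_smul_eq_self_iff, inv_smul_smul]
      · rw [Ne, conj_smul_eq_self_iff]
        exact hab' _ ((smul_lt_iff_of_monotone hm).1 h1)
    have hlast : f' • h⁻¹ • T • a = h⁻¹ • T • a := by
      obtain ⟨g, k, hk, rfl⟩ := hh
      refine hF.fixed_of_fixed_forward_conj htriv hk (g := g) fun n => ?_
      rw [pow_succ_smul_inv_smul]
      exact hfix n
    exact hab' _ ((smul_lt_iff_of_monotone hm).1 hlt) hlast

/-- A fixed point to the right of T • x is handled by reversing the order and replacing T by T⁻¹. -/
theorem IsSubexpChain.exists_fixed_mem_Icc (hm : ∀ g : G, Monotone fun x : X => g • x)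
    {F : ℕ → Subgroup G} {m : ℕ} (hF : IsSubexpChain F (m + 1))
    (htriv : ∀ g ∈ F (m + 1), ∀ x : X, g • x = x) {T : G} (hT : ∀ x : X, x < T • x)
    {f : G} (hf : f ∈ conjugatesIn (F m)) {p : X} (hp : f • p = p) (x : X) :
    ∃ y, x ≤ y ∧ y ≤ T • x ∧ f • y = y := by
  rcases lt_or_ge p x with h | h
  · exact hF.exists_fixed_of_fixed_lt hm htriv hT hf hp h
  rcases lt_or_ge (T • x) p with h' | h'
  · obtain ⟨y, h1, h2, h3⟩ := hF.exists_fixed_of_fixed_lt (X := Xᵒᵈ) (monotone_smul_orderDual hm)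
      htriv (T := T⁻¹) (fun z => (smul_lt_iff_of_monotone hm (X := X)).2 (by simpa using hT _)) hf
      (p := OrderDual.toDual p) hp (x := OrderDual.toDual (T • x)) h'
    refine ⟨OrderDual.ofDual y, ?_, h1, h3⟩
    have : T⁻¹ • T • x ≤ OrderDual.ofDual y := h2
    rwa [inv_smul_smul] at this
  · exact ⟨p, h, h', hp⟩

/-- The conjugates of elements of the bottom of a chain that have a fixed point have a common
fixed point. -/
theorem IsSubexpChain.exists_common_fixed (hm : ∀ g : G, Monotone fun x : X => g • x)
    {F : ℕ → Subgroup G} {m : ℕ} (hF : IsSubexpChain F (m + 1))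
    (htriv : ∀ g ∈ F (m + 1), ∀ x : X, g • x = x) {T : G} (hT : ∀ x : X, x < T • x) :
    ∃ r : X, ∀ f ∈ conjugatesIn (F m), (∃ p : X, f • p = p) → f • r = r := by
  have x : X := sSup ∅
  -- The common fixed point is the supremum of all first fixed points after x. Were it not fixed by
  -- f, some first fixed point b would lie beyond the last fixed point c of f before it, and f would
  -- be crossed on (c, b) with the element belonging to b.
  set s : Set X := {b | x ≤ b ∧ b ≤ T • x ∧ ∃ f ∈ conjugatesIn (F m),
    f • b = b ∧ ∀ y, x ≤ y → y < b → f • y ≠ y}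
  have hfirst : ∀ f ∈ conjugatesIn (F m), (∃ p : X, f • p = p) → ∃ b ∈ s, f • b = b := by
    rintro f hf ⟨p, hp⟩
    obtain ⟨y, h1, h2, h3⟩ := hF.exists_fixed_mem_Icc hm htriv hT hf hp x
    obtain ⟨b, hb1, hb2, hb3, hb4⟩ := exists_first_fixed hm h3 h1
    exact ⟨b, ⟨hb1, hb2.trans h2, f, hf, hb3, hb4⟩, hb3⟩
  have hbdd : BddAbove s := ⟨T • x, fun b hb => hb.2.1⟩
  refine ⟨sSup s, fun f hf hp => ?_⟩
  by_contra hne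
  obtain ⟨p, hps, hfp⟩ := hfirst f hf hp
  obtain ⟨c, hpc, hcr, hfc, hcfree⟩ := exists_last_fixed hm hfp (le_csSup hbdd hps)
  have hcr' : c < sSup s := lt_of_le_of_ne hcr fun h => hne (h ▸ hfc)
  obtain ⟨b, hb, hcb⟩ := exists_lt_of_lt_csSup ⟨p, hps⟩ hcr'
  have hbs := le_csSup hbdd hb
  obtain ⟨hxb, -, f₂, hf₂, hf₂b, hf₂free⟩ := hb
  exact hF.not_crossed_conjugatesIn hm htriv hf₂ hf ⟨c, b, hcb, hf₂b, hfc,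
    fun y h1 h2 => hf₂free y ((hps.1.trans hpc).trans h1) h2,
    fun y h1 h2 => hcfree y h1 (h2.trans hbs)⟩

end Crossing

/-! ### Hölder's theorem -/

section Translations

variable {G X : Type*} [Group G] [ConditionallyCompleteLinearOrder X] [MulAction G X]

theorem zpow_smul_strictMono (hm : ∀ g : G, Monotone fun x : X => g • x) {T : G}
    (hT : ∀ x : X, x < T • x) (y : X) : StrictMono fun k : ℤ => T ^ k • y := by
  refine strictMono_int_of_lt_succ fun k => ?_
  rw [zpow_add_one, mul_smul]
  exact smul_lt_smul_of_monotone hm _ (hT y)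

theorem exists_lt_pow_smul_of_forall_lt (hm : ∀ g : G, Monotone fun x : X => g • x) {T : G}
    (hT : ∀ x : X, x < T • x) (y x : X) : ∃ k : ℕ, x < T ^ k • y :=
  exists_lt_pow_smul hm (hT y).le fun z _ _ => (hT z).ne'

theorem exists_inv_pow_smul_lt (hm : ∀ g : G, Monotone fun x : X => g • x) {T : G}
    (hT : ∀ x : X, x < T • x) (y x : X) : ∃ k : ℕ, T⁻¹ ^ k • y < x := by
  have hT' : ∀ z : X, T⁻¹ • z < z := fun z => by
    rw [smul_lt_iff_of_monotone hm, inv_inv]; exact hT z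
  exact exists_pow_smul_lt hm (hT' y).le fun z _ _ => (hT' z).ne

/-- The orbit of `y` under a fixed-point-free element cuts the line into fundamental domains. -/
theorem exists_zpow_smul_le_lt (hm : ∀ g : G, Monotone fun x : X => g • x) {T : G}
    (hT : ∀ x : X, x < T • x) (y x : X) : ∃ k : ℤ, T ^ k • y ≤ x ∧ x < T ^ (k + 1) • y := by
  have hmono := zpow_smul_strictMono hm hT y
  obtain ⟨n, hn⟩ := exists_lt_pow_smul_of_forall_lt hm hT y x
  obtain ⟨n', hn'⟩ := exists_inv_pow_smul_lt hm hT y x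
  obtain ⟨k, hk, hmax⟩ := Int.exists_greatest_of_bdd (P := fun k : ℤ => T ^ k • y ≤ x)
    ⟨n, fun z hz => hmono.le_iff_le.1 (hz.trans (by simpa using hn.le))⟩
    ⟨-n', by simpa using hn'.le⟩
  exact ⟨k, hk, lt_of_not_ge fun h => by have := hmax _ h; omega⟩

/-- For a semifree action, the order between `f • y` and `g • y` does not depend on `y`. -/
theorem smul_le_smul_of_semifree (hm : ∀ g : G, Monotone fun x : X => g • x)
    (hsf : ∀ f : G, (∃ p : X, f • p = p) → ∀ x : X, f • x = x) {f g : G} {y : X}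
    (h : f • y ≤ g • y) (z : X) : f • z ≤ g • z := by
  by_contra! hz
  have hz' : z < (g⁻¹ * f) • z := by
    rw [mul_smul, lt_smul_iff_of_monotone hm, inv_inv]; exact hz
  have hy' : (g⁻¹ * f) • y ≤ y := by
    rw [mul_smul]; simpa using hm g⁻¹ h
  refine (lt_smul_of_forall_ne hm (fun x hx => ?_) hz' y).not_ge hy'
  exact hz'.ne' (hsf _ ⟨x, hx⟩ z)

theorem smul_lt_smul_of_semifree (hm : ∀ g : G, Monotone fun x : X => g • x)
    (hsf : ∀ f : G, (∃ p : X, f • p = p) → ∀ x : X, f • x = x) {f g : G} {y : X}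
    (h : f • y < g • y) (z : X) : f • z < g • z :=
  lt_of_not_ge fun h' => (smul_le_smul_of_semifree hm hsf h' y).not_gt h

/-- A group acting freely by monotone maps is commutative. -/
theorem mul_comm_of_free (hm : ∀ g : G, Monotone fun x : X => g • x)
    (hfree : ∀ f : G, ∀ p : X, f • p = p → f = 1) (a b : G) : a * b = b * a := by
  have hsf : ∀ f : G, (∃ p : X, f • p = p) → ∀ x : X, f • x = x := by
    rintro f ⟨p, hp⟩ x
    rw [hfree f p hp, one_smul]
  have y : X := sSup ∅
  have hinj : ∀ f g : G, f • y = g • y → f = g := fun f g h => by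
    have := hfree (g⁻¹ * f) y (by rw [mul_smul, h, inv_smul_smul])
    exact (inv_mul_eq_one.1 this).symm
  have hpos : ∀ d : G, y < d • y → ∀ x : X, x < d • x := fun d hd x => by
    simpa using smul_lt_smul_of_semifree hm hsf (f := 1) (g := d) (by simpa using hd) x
  by_cases hleast : ∃ d : G, y < d • y ∧ ∀ e : G, y < e • y → d • y ≤ e • y
  -- A least positive element generates the group.
  · obtain ⟨d, hd, hmin⟩ := hleast
    have hgen : ∀ f : G, ∃ k : ℤ, f = d ^ k := by
      intro f
      obtain ⟨k, hk1, hk2⟩ := exists_zpow_smul_le_lt hm (hpos d hd) y (f • y)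
      refine ⟨k, hinj _ _ (le_antisymm ?_ hk1)⟩
      by_contra! hlt
      have h1 : y < (((d ^ k)⁻¹ : G) * f) • y := by
        rw [mul_smul, lt_smul_iff_of_monotone hm, inv_inv]; exact hlt
      have h2 := hmin _ h1
      have h3 := hm (d ^ k) h2
      simp only [mul_smul, smul_inv_smul] at h3
      rw [zpow_add_one, mul_smul] at hk2
      exact h3.not_gt hk2
    obtain ⟨k, rfl⟩ := hgen a
    obtain ⟨l, rfl⟩ := hgen b
    exact (Commute.refl d).zpow_zpow k l
  · push Not at hleast
    have key : ∀ a b : G, ¬ (b * a) • y < (a * b) • y := by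
      intro a b hab
      set c := (b * a)⁻¹ * (a * b) with hc
      have hcy : y < c • y := by
        rw [hc, mul_smul, lt_smul_iff_of_monotone hm, inv_inv]; exact hab
      obtain ⟨e, he, hec⟩ := hleast c hcy
      -- Of e and e⁻¹ * c, the smaller one has square at most c. Bracketing a and b between
      -- consecutive powers of d then gives c < d * d.
      obtain ⟨d, hd, hdd⟩ : ∃ d : G, y < d • y ∧ (d * d) • y ≤ c • y := by
        have he' : y < (e⁻¹ * c) • y := by
          rw [mul_smul, lt_smul_iff_of_monotone hm, inv_inv]; exact hec
        rcases le_total (e • y) ((e⁻¹ * c) • y) with h | h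
        · refine ⟨e, he, ?_⟩
          have := hm e h
          simpa only [mul_smul, smul_inv_smul] using this
        · refine ⟨e⁻¹ * c, he', ?_⟩
          have := smul_le_smul_of_semifree hm hsf h ((e⁻¹ * c) • y)
          rw [mul_smul (e⁻¹ * c)]
          refine this.trans ?_
          rw [mul_smul, smul_inv_smul]
      obtain ⟨k, hk1, hk2⟩ := exists_zpow_smul_le_lt hm (hpos d hd) y (a • y)
      obtain ⟨l, hl1, hl2⟩ := exists_zpow_smul_le_lt hm (hpos d hd) y (b • y)
      have h1 : (a * b) • y < d ^ (k + 1) • d ^ (l + 1) • y := by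
        rw [mul_smul]
        exact (smul_lt_smul_of_monotone hm a hl2).trans
          (smul_lt_smul_of_semifree hm hsf hk2 _)
      have h2 : d ^ l • d ^ k • y ≤ (b * a) • y := by
        rw [mul_smul]
        exact (hm (d ^ l) hk1).trans (smul_le_smul_of_semifree hm hsf hl1 _)
      have h3 : c • y < (d * d) • y := by
        have e1 : d ^ (k + 1) • d ^ (l + 1) • y = (d ^ l * d ^ k) • (d * d) • y := by
          simp only [← mul_smul]
          congr 1
          group
        rw [e1, ← mul_smul] at h1
        have h4 : (d ^ l * d ^ k) • (d * d) • y ≤ (b * a) • (d * d) • y :=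
          smul_le_smul_of_semifree hm hsf (y := y) (by rwa [mul_smul]) _
        rw [← mul_smul] at h4
        have h5 := h1.trans_le h4
        rw [lt_smul_iff_of_monotone hm, ← mul_smul] at h5
        exact h5
      exact h3.not_ge hdd
    exact hinj _ _ (le_antisymm (not_lt.1 (key a b)) (not_lt.1 (key b a)))

/-- Hölder's theorem for free actions. -/
theorem exists_translation_of_free (hm : ∀ g : G, Monotone fun x : X => g • x)
    (hfree : ∀ f : G, ∀ p : X, f • p = p → f = 1) :
    ∃ τ : G → ℝ, (∀ f g, τ (f * g) = τ f + τ g) ∧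
      ∀ f g, ∀ y : X, τ f ≤ τ g ↔ f • y ≤ g • y := by
  have hsf : ∀ f : G, (∃ p : X, f • p = p) → ∀ x : X, f • x = x := by
    rintro f ⟨p, hp⟩ x
    rw [hfree f p hp, one_smul]
  have y : X := sSup ∅
  let _ : CommGroup G := { (inferInstance : Group G) with mul_comm := mul_comm_of_free hm hfree }
  -- The group is ordered by the orbit of y; iterates of a positive element exceed every point, so
  -- the order is Archimedean.
  let _ : LinearOrder G := LinearOrder.lift' (fun g : G => g • y) fun f g h => by
    have := hfree (g⁻¹ * f) y (by
      rw [mul_smul, inv_smul_eq_iff]; exact h)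
    exact (inv_mul_eq_one.1 this).symm
  have hle : ∀ f g : G, f ≤ g ↔ f • y ≤ g • y := fun f g => Iff.rfl
  have : IsOrderedMonoid G :=
    { mul_le_mul_left := fun f g h k => by
        rw [mul_comm f, mul_comm g, hle, mul_smul, mul_smul]; exact hm k h }
  have : Archimedean (Additive G) := ⟨fun x d hd => by
    have hd' : y < d.toMul • y := by
      have : (1 : G) • y < d.toMul • y := hd
      simpa using this
    have hpos : ∀ x : X, x < d.toMul • x := fun x => by
      simpa using smul_lt_smul_of_semifree hm hsf (f := 1) (g := d.toMul) (by simpa using hd') x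
    obtain ⟨n, hn⟩ := exists_lt_pow_smul_of_forall_lt hm hpos y (x.toMul • y)
    exact ⟨n, hn.le⟩⟩
  obtain ⟨φ, hφ⟩ := Archimedean.exists_orderAddMonoidHom_real_injective (Additive G)
  have hφm : StrictMono φ := φ.monotone'.strictMono_of_injective hφ
  refine ⟨fun g => φ (Additive.ofMul g), fun f g => map_add φ _ _, fun f g z => ?_⟩
  rw [hφm.le_iff_le]
  exact ⟨fun h => smul_le_smul_of_semifree hm hsf ((hle f g).1 h) z,
    fun h => (hle f g).2 (smul_le_smul_of_semifree hm hsf h y)⟩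

/-- Hölder's theorem for semifree actions. -/
theorem exists_translation_of_semifree (hm : ∀ g : G, Monotone fun x : X => g • x)
    (hsf : ∀ f : G, (∃ p : X, f • p = p) → ∀ x : X, f • x = x) :
    ∃ τ : G → ℝ, (∀ f g, τ (f * g) = τ f + τ g) ∧
      ∀ f g, ∀ y : X, τ f ≤ τ g ↔ f • y ≤ g • y := by
  let φ := MulAction.toPermHom G X
  have hsmul : ∀ (f : G) (x : X), φ.rangeRestrict f • x = f • x := fun f x => rfl
  obtain ⟨τ, h1, h2⟩ := exists_translation_of_free (G := φ.range) (X := X) (by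
      rintro ⟨_, f, rfl⟩
      exact hm f) (by
      rintro ⟨_, f, rfl⟩ p hp
      ext x
      exact hsf f ⟨p, hp⟩ x)
  refine ⟨fun f => τ (φ.rangeRestrict f), fun f g => ?_, fun f g y => ?_⟩
  · rw [← h1, ← map_mul]
  · rw [h2 _ _ y, hsmul, hsmul]

end Translations

/-! ### Developing maps, their uniqueness, and the dense case -/

section Developing

variable {G X : Type*} [Group G] [ConditionallyCompleteLinearOrder X] [MulAction G X]

theorem map_one_of_additive {τ : G → ℝ} (hadd : ∀ f g, τ (f * g) = τ f + τ g) : τ 1 = 0 := by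
  have := hadd 1 1
  rw [mul_one] at this
  linarith

theorem map_zpow_of_additive {τ : G → ℝ} (hadd : ∀ f g, τ (f * g) = τ f + τ g) (f : G) (k : ℤ) :
    τ (f ^ k) = k * τ f := by
  have := map_zsmul (AddMonoidHom.mk' (fun a : Additive G => τ a.toMul) fun a b => hadd _ _) k
    (Additive.ofMul f)
  simpa using this

theorem map_pow_of_additive {τ : G → ℝ} (hadd : ∀ f g, τ (f * g) = τ f + τ g) (f : G) (k : ℕ) :
    τ (f ^ k) = k * τ f := by
  simpa using map_zpow_of_additive hadd f k

/-- A monotone map on which the semifree group acts through the translations `τ`. -/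
theorem exists_developing (hm : ∀ g : G, Monotone fun x : X => g • x)
    {τ : G → ℝ} (hadd : ∀ f g, τ (f * g) = τ f + τ g)
    (hτ : ∀ f g, ∀ y : X, τ f ≤ τ g ↔ f • y ≤ g • y) {T : G} (hT : ∀ x : X, x < T • x) :
    ∃ Φ : X → ℝ, Monotone Φ ∧ ∀ g x, Φ (g • x) = Φ x + τ g := by
  have y : X := sSup ∅
  have hne : ∀ x : X, (τ '' {f | f • y ≤ x}).Nonempty := fun x => by
    obtain ⟨k, hk⟩ := exists_inv_pow_smul_lt hm hT y x
    exact ⟨_, _, hk.le, rfl⟩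
  have hbdd : ∀ x : X, BddAbove (τ '' {f | f • y ≤ x}) := fun x => by
    obtain ⟨k, hk⟩ := exists_lt_pow_smul_of_forall_lt hm hT y x
    refine ⟨τ (T ^ k), ?_⟩
    rintro _ ⟨f, hf, rfl⟩
    exact (hτ _ _ y).2 (le_trans hf hk.le)
  have hle : ∀ g x, sSup (τ '' {f | f • y ≤ x}) + τ g ≤ sSup (τ '' {f | f • y ≤ g • x}) := by
    intro g x
    rw [← le_sub_iff_add_le]
    refine csSup_le (hne x) ?_
    rintro _ ⟨f, hf, rfl⟩
    rw [le_sub_iff_add_le, add_comm, ← hadd]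
    refine le_csSup (hbdd _) ⟨g * f, ?_, rfl⟩
    change (g * f) • y ≤ g • x
    rw [mul_smul]
    exact hm g hf
  -- Φ(x) is the supremum of the translation lengths of elements not carrying y beyond x. The
  -- inequality `hle` for g⁻¹ is the converse of that for g.
  refine ⟨fun x => sSup (τ '' {f | f • y ≤ x}), fun a b hab => ?_, fun g x => ?_⟩
  · exact csSup_le_csSup (hbdd b) (hne a) (Set.image_mono fun f hf => le_trans hf hab)
  · refine le_antisymm ?_ (hle g x)
    have h1 := hle g⁻¹ (g • x)
    rw [inv_smul_smul] at h1
    have h2 := hadd g⁻¹ g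
    rw [inv_mul_cancel, map_one_of_additive hadd] at h2
    linarith

theorem pos_of_developing {τ : G → ℝ} (hadd : ∀ f g, τ (f * g) = τ f + τ g)
    (hτ : ∀ f g, ∀ y : X, τ f ≤ τ g ↔ f • y ≤ g • y) {T : G} (hT : ∀ x : X, x < T • x) :
    0 < τ T := by
  have y : X := sSup ∅
  rw [← map_one_of_additive hadd, ← not_le, hτ T 1 y, one_smul, not_le]
  exact hT y

theorem developing_unbounded {τ : G → ℝ} (hadd : ∀ f g, τ (f * g) = τ f + τ g) {Φ : X → ℝ}
    (hΦ : ∀ g x, Φ (g • x) = Φ x + τ g) {T : G} (hT : 0 < τ T) (t : ℝ) :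
    (∃ x, t < Φ x) ∧ ∃ x, Φ x < t := by
  have y : X := sSup ∅
  have key : ∀ s : ℝ, ∃ k : ℤ, s < k * τ T := fun s => by
    obtain ⟨n, hn⟩ := exists_nat_gt (s / τ T)
    exact ⟨n, by rw [div_lt_iff₀ hT] at hn; exact_mod_cast hn⟩
  obtain ⟨k, hk⟩ := key (t - Φ y)
  obtain ⟨l, hl⟩ := key (Φ y - t)
  refine ⟨⟨T ^ k • y, ?_⟩, ⟨T ^ (-l) • y, ?_⟩⟩
  · rw [hΦ, map_zpow_of_additive hadd]; linarith
  · rw [hΦ, map_zpow_of_additive hadd]; push_cast; linarith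

/-- Monotone homomorphisms to `ℝ` are proportional to the translation homomorphism. -/
theorem translation_unique {τ τ' : G → ℝ} (hadd : ∀ f g, τ (f * g) = τ f + τ g)
    (hadd' : ∀ f g, τ' (f * g) = τ' f + τ' g) (hle : ∀ f g, τ f ≤ τ g → τ' f ≤ τ' g) {T : G}
    (hT : 0 < τ T) (f : G) : τ' f = τ' T / τ T * τ f := by
  have hu : 0 ≤ τ' T := by
    have := hle 1 T (by rw [map_one_of_additive hadd]; exact hT.le)
    rwa [map_one_of_additive hadd'] at this
  have key : ∀ f, τ' f ≤ τ' T / τ T * τ f := by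
    intro f
    -- For r = p/q, compare f ^ q with T ^ p.
    have hr : ∀ r : ℚ, τ f / τ T < r → τ' f ≤ r * τ' T := by
      intro r hr
      have hden : (0 : ℝ) < r.den := by exact_mod_cast r.den_pos
      have hr' : (r : ℝ) = r.num / r.den := Rat.cast_def r
      have h1 : τ (f ^ r.den) ≤ τ (T ^ r.num) := by
        rw [map_pow_of_additive hadd, map_zpow_of_additive hadd]
        rw [hr', div_lt_div_iff₀ hT hden] at hr
        linarith
      have h2 := hle _ _ h1
      rw [map_pow_of_additive hadd', map_zpow_of_additive hadd'] at h2
      rw [hr', div_mul_eq_mul_div, le_div_iff₀ hden]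
      linarith
    by_contra! hlt
    rcases hu.eq_or_lt with h0 | hpos
    · rw [← h0, zero_div, zero_mul] at hlt
      obtain ⟨r, hr1, -⟩ := exists_rat_btwn (lt_add_one (τ f / τ T))
      have := hr r hr1
      rw [← h0, mul_zero] at this
      exact this.not_gt hlt
    · have : τ f / τ T < τ' f / τ' T := by
        rw [lt_div_iff₀ hpos]
        calc τ f / τ T * τ' T = τ' T / τ T * τ f := by ring
          _ < τ' f := hlt
      obtain ⟨r, hr1, hr2⟩ := exists_rat_btwn this
      have h3 := hr r hr1
      rw [lt_div_iff₀ hpos] at hr2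
      exact h3.not_gt hr2
  refine le_antisymm (key f) ?_
  have h1 := key f⁻¹
  have hinv : τ f⁻¹ = -τ f := by simpa using map_zpow_of_additive hadd f (-1)
  have hinv' : τ' f⁻¹ = -τ' f := by simpa using map_zpow_of_additive hadd' f (-1)
  rw [hinv, hinv'] at h1
  linarith

/-- If the translations are dense, then the developing map is unique up to affine maps. -/
theorem developing_unique (hm : ∀ g : G, Monotone fun x : X => g • x)
    {τ : G → ℝ} (hadd : ∀ f g, τ (f * g) = τ f + τ g)
    (hτ : ∀ f g, ∀ y : X, τ f ≤ τ g ↔ f • y ≤ g • y) {T : G} (hT : ∀ x : X, x < T • x)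
    (hdense : Dense (Set.range τ)) {Φ : X → ℝ} (hΦm : Monotone Φ)
    (hΦ : ∀ g x, Φ (g • x) = Φ x + τ g) {Ψ : X → ℝ} (hΨm : Monotone Ψ)
    (hΨne : ∃ x y, Ψ x ≠ Ψ y) {τ' : G → ℝ} (hΨ : ∀ g x, Ψ (g • x) = Ψ x + τ' g) :
    ∃ l : ℝ, 0 < l ∧ ∃ c, ∀ x, Ψ x = l * Φ x + c := by
  have y₀ : X := sSup ∅
  have hTpos := pos_of_developing hadd hτ hT
  have hadd' : ∀ f g, τ' (f * g) = τ' f + τ' g := fun f g => by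
    have h1 := hΨ (f * g) y₀
    rw [mul_smul, hΨ, hΨ] at h1
    linarith
  have hle : ∀ f g, τ f ≤ τ g → τ' f ≤ τ' g := fun f g h => by
    have h1 := hΨm ((hτ f g y₀).1 h)
    rw [hΨ, hΨ] at h1
    linarith
  have hprop := translation_unique hadd hadd' hle hTpos
  set l := τ' T / τ T
  have hl : 0 < l := by
    have h0 : 0 ≤ τ' T := by
      have := hle 1 T (by rw [map_one_of_additive hadd]; exact hTpos.le)
      rwa [map_one_of_additive hadd'] at this
    refine div_pos (lt_of_le_of_ne h0 fun hz => ?_) hTpos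
    -- If τ' T = 0, then Ψ is constant on a T-orbit, which is cofinal in both directions.
    have hconst : ∀ x, Ψ x = Ψ y₀ := fun x => by
      obtain ⟨k, h1, h2⟩ := exists_zpow_smul_le_lt hm hT y₀ x
      have h3 := hΨm h1
      have h4 := hΨm h2.le
      rw [hΨ, map_zpow_of_additive hadd', ← hz] at h3 h4
      simp only [mul_zero, add_zero] at h3 h4
      exact le_antisymm h4 h3
    obtain ⟨x, y, hxy⟩ := hΨne
    exact hxy ((hconst x).trans (hconst y).symm)
  have key : ∀ x y, Ψ x - Ψ y ≤ l * (Φ x - Φ y) := by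
    intro x y
    by_contra! hlt
    rw [← lt_div_iff₀' hl] at hlt
    -- Density gives f with Φ x - Φ y < τ f < (Ψ x - Ψ y) / l. The first inequality forces x ≤ f •
    -- y, which Ψ contradicts by the second.
    obtain ⟨_, ⟨f, rfl⟩, h1, h2⟩ := hdense.exists_mem_open isOpen_Ioo (Set.nonempty_Ioo.2 hlt)
    have h3 : x ≤ f • y := le_of_not_ge fun h => by
      have := hΦm h
      rw [hΦ] at this
      linarith
    have h4 := hΨm h3
    rw [hΨ, hprop] at h4
    rw [lt_div_iff₀' hl] at h2
    linarith
  refine ⟨l, hl, Ψ y₀ - l * Φ y₀, fun x => ?_⟩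
  have h1 := key x y₀
  have h2 := key y₀ x
  linarith

/-- An element that is trivial as soon as it has a fixed point acts on the values of a developing
map by a translation. -/
theorem factor_eq_one (hm : ∀ g : G, Monotone fun x : X => g • x) {k : G}
    (hk : (∃ p : X, k • p = p) → ∀ x : X, k • x = x) {Φ : X → ℝ} (hΦm : Monotone Φ)
    (hub : ∀ t, (∃ x, t < Φ x) ∧ ∃ x, Φ x < t) {l c : ℝ} (hl : 0 < l)
    (hkΦ : ∀ x, Φ (k • x) = l * Φ x + c) : l = 1 := by
  by_contra hne
  have hne' : 1 - l ≠ 0 := sub_ne_zero.2 (Ne.symm hne)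
  have htriv : ∀ x : X, k • x = x := by
    -- For l ≠ 1 the affine map fixes t, so k fixes the supremum of {Φ ≤ t} and hence acts
    -- trivially. Then Φ would be constantly t.
    set t := c / (1 - l)
    have ht : l * t + c = t := by
      have : c = t * (1 - l) := (div_mul_cancel₀ c hne').symm
      rw [this]; ring
    have hinv : ∀ x, Φ (k • x) ≤ t ↔ Φ x ≤ t := fun x => by
      rw [hkΦ]
      nth_rewrite 1 [← ht]
      rw [add_le_add_iff_right, mul_le_mul_iff_right₀ hl]
    obtain ⟨⟨b, hb⟩, a, ha⟩ := hub t
    have hbd : BddAbove {x | Φ x ≤ t} := ⟨b, fun x hx => le_of_not_gt fun h =>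
      (hb.trans_le (hΦm h.le)).not_ge hx⟩
    refine hk ⟨_, smul_csSup_eq_self hm ⟨a, ha.le⟩ hbd (fun x hx => (hinv x).2 hx) fun x hx => ?_⟩
    refine ⟨k⁻¹ • x, (hinv _).1 ?_, ?_⟩ <;> rw [smul_inv_smul]
    exact hx
  obtain ⟨x, hx⟩ := (hub (c / (1 - l))).1
  have h1 := hkΦ x
  rw [htriv x] at h1
  have : Φ x = c / (1 - l) := by
    rw [eq_div_iff hne']; linarith
  exact hx.ne' this

/-- The affine-equivariant maps that quasi-invariant measures come from. -/
def HasAffineDeveloping (G X : Type*) [Group G] [Preorder X] [MulAction G X] : Prop :=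
  ∃ Φ : X → ℝ, Monotone Φ ∧ (∃ x y, Φ x ≠ Φ y) ∧
    ∀ g : G, ∃ l : ℝ, 0 < l ∧ ∃ c, ∀ x, Φ (g • x) = l * Φ x + c

/-- Climb the chain. For g in F j and f in F m, the conjugate g * f * g⁻¹ lies in F (j + 1), so it
acts affinely on values of Φ, and with factor 1 by semifreeness. Hence Φ ∘ g is again equivariant by
translations under F m, and uniqueness makes it affine in Φ. -/
theorem IsSubexpChain.hasAffineDeveloping_of_dense (hm : ∀ g : G, Monotone fun x : X => g • x)
    {F : ℕ → Subgroup G} {m : ℕ} (hF : IsSubexpChain F (m + 1))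
    (hsf : ∀ f ∈ F m, (∃ p : X, f • p = p) → ∀ x : X, f • x = x)
    {τ : F m → ℝ} (hadd : ∀ f g, τ (f * g) = τ f + τ g)
    (hτ : ∀ f g, ∀ y : X, τ f ≤ τ g ↔ f • y ≤ g • y) {T : F m} (hT : ∀ x : X, x < T • x)
    (hdense : Dense (Set.range τ)) : HasAffineDeveloping G X := by
  have hm' : ∀ g : F m, Monotone fun x : X => g • x := fun g => hm g
  obtain ⟨Φ, hΦm, hΦ⟩ := exists_developing hm' hadd hτ hT
  have hub := developing_unbounded hadd hΦ (pos_of_developing hadd hτ hT)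
  have hne : ∃ x y, Φ x ≠ Φ y := by
    obtain ⟨⟨x, hx⟩, y, hy⟩ := hub 0
    exact ⟨x, y, (hy.trans hx).ne'⟩
  have key : ∀ j ≤ m, ∀ g ∈ F j, ∃ l : ℝ, 0 < l ∧ ∃ c, ∀ x, Φ (g • x) = l * Φ x + c := by
    intro j hj
    induction hj using Nat.decreasingInduction with
    | self => exact fun g hg => ⟨1, one_pos, τ ⟨g, hg⟩, fun x => by rw [one_mul]; exact hΦ ⟨g, hg⟩ x⟩
    | of_succ j hj ih =>
      intro g hg
      have htrans : ∀ f : F m, ∃ c, ∀ x, Φ (g • f • x) = Φ (g • x) + c := by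
        intro f
        obtain ⟨l, hl, c, hc⟩ := ih (g * f * g⁻¹)
          (hF.conj_mem j (by omega) g hg f (hF.le_of_le (by omega) (by omega) f.2))
        have hl1 : l = 1 := by
          refine factor_eq_one hm ?_ hΦm hub hl hc
          rintro ⟨p, hp⟩ x
          rw [conj_smul_eq_self_iff] at hp ⊢
          exact hsf f f.2 ⟨_, hp⟩ _
        refine ⟨c, fun x => ?_⟩
        have := hc (g • x)
        rw [hl1, one_mul, mul_smul, mul_smul, inv_smul_smul] at this
        exact this
      choose τ' hτ' using htrans
      refine developing_unique hm' hadd hτ hT hdense hΦm hΦ (Ψ := fun x => Φ (g • x))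
        (hΦm.comp (hm g)) ?_ hτ'
      obtain ⟨x, y, hxy⟩ := hne
      exact ⟨g⁻¹ • x, g⁻¹ • y, by simpa using hxy⟩
  exact ⟨Φ, hΦm, hne, fun g => key 0 (Nat.zero_le _) g (hF.zero ▸ Subgroup.mem_top g)⟩

end Developing

/-! ### The cyclic case: shortening the chain -/

section Cyclic

variable {G X : Type*} [Group G] [ConditionallyCompleteLinearOrder X] [MulAction G X]

theorem eventually_linear_mul_pow_le (d : ℝ) {c' c : ℝ} (hc' : 0 < c') (hc : c' < c) :
    ∀ᶠ n : ℕ in atTop, (d * n + 1) * c' ^ n ≤ c ^ n := by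
  have hc0 : 0 < c := hc'.trans hc
  have hr : |c' / c| < 1 := by
    rw [abs_of_pos (div_pos hc' hc0)]
    exact (div_lt_one hc0).2 hc
  have h1 := (tendsto_pow_const_mul_const_pow_of_abs_lt_one 1 hr).const_mul d
  have h2 := h1.add (tendsto_pow_atTop_nhds_zero_of_abs_lt_one hr)
  simp only [pow_one, mul_zero, add_zero] at h2
  filter_upwards [h2.eventually (ge_mem_nhds (zero_lt_one (α := ℝ)))] with n hn
  rw [div_pow, ← mul_assoc, ← add_one_mul, ← mul_div_assoc, div_le_one (pow_pos hc0 n)] at hn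
  exact hn

/-- A group commuting with a fixed-point-free `T`, with subexponential growth modulo elements
acting as powers of `T`, has subexponential growth modulo the kernel of the action. -/
theorem SubexpMod.of_commute (hm : ∀ g : G, Monotone fun x : X => g • x) {P N : Subgroup G}
    (hPN : SubexpMod P N) {T : G} (hT : ∀ x : X, x < T • x)
    (hcyc : ∀ f ∈ N, ∃ k : ℤ, ∀ x : X, f • x = T ^ k • x)
    (hcomm : ∀ g ∈ P, ∀ x : X, g • T • x = T • g • x) :
    SubexpMod P (P ⊓ (MulAction.toPermHom G X).ker) := by
  classical
  have y : X := sSup ∅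
  have hmono := zpow_smul_strictMono hm hT y
  have hcomm' : ∀ g ∈ P, ∀ (k : ℤ) (x : X), g • T ^ k • x = T ^ k • g • x := by
    intro g hg k x
    have h1 : Commute (MulAction.toPermHom G X g) (MulAction.toPermHom G X T) :=
      Equiv.ext fun x => hcomm g hg x
    have h2 := h1.zpow_right k
    rw [← map_zpow] at h2
    exact congrArg (fun e : Equiv.Perm X => e x) h2.eq
  have hbd : ∀ g : G, ∃ d : ℕ, ∀ e : ℕ, d ≤ e → T ^ (-(e : ℤ)) • y ≤ g • y ∧
      g • y ≤ T ^ (e : ℤ) • y := by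
    intro g
    obtain ⟨k, h1, h2⟩ := exists_zpow_smul_le_lt hm hT y (g • y)
    refine ⟨(k + 1).natAbs + k.natAbs, fun e he => ⟨le_trans ?_ h1, h2.le.trans ?_⟩⟩
    · exact hmono.monotone (by omega)
    · exact hmono.monotone (by omega)
  intro a ha b hb c hc
  obtain ⟨d₁, hd₁⟩ := hbd a
  obtain ⟨d₂, hd₂⟩ := hbd b
  set d := max d₁ d₂ with hd
  have hmem : ∀ g ∈ ({a, b} : Set G), g ∈ P ∧ T ^ (-(d : ℤ)) • y ≤ g • y ∧
      g • y ≤ T ^ (d : ℤ) • y := by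
    rintro g (rfl | rfl)
    · exact ⟨ha, hd₁ d (le_max_left _ _)⟩
    · exact ⟨hb, hd₂ d (le_max_right _ _)⟩
  -- Since P commutes with T, displacements of y, measured in powers of T, grow at most linearly
  -- with word length.
  have hword : ∀ n : ℕ, ∀ u ∈ ({a, b} : Set G) ^ n, u ∈ P ∧ T ^ (-((d * n : ℕ) : ℤ)) • y ≤ u • y ∧
      u • y ≤ T ^ ((d * n : ℕ) : ℤ) • y := by
    intro n
    induction n with
    | zero => simp [P.one_mem]
    | succ n ih =>
      intro u hu
      rw [pow_succ', Set.mem_mul] at hu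
      obtain ⟨g, hg, v, hv, rfl⟩ := hu
      obtain ⟨hgP, hg1, hg2⟩ := hmem g hg
      obtain ⟨hvP, hv1, hv2⟩ := ih v hv
      refine ⟨P.mul_mem hgP hvP, ?_, ?_⟩
      · have h1 := hm g hv1
        have h2 := hm (T ^ (-((d * n : ℕ) : ℤ))) hg1
        simp only at h1 h2
        rw [hcomm' g hgP] at h1
        rw [mul_smul]
        refine le_trans (le_of_eq ?_) (h2.trans h1)
        rw [← mul_smul, ← zpow_add]
        congr 2
        push_cast
        ring
      · have h1 := hm g hv2
        have h2 := hm (T ^ ((d * n : ℕ) : ℤ)) hg2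
        simp only at h1 h2
        rw [hcomm' g hgP] at h1
        rw [mul_smul]
        refine (h1.trans h2).trans (le_of_eq ?_)
        rw [← mul_smul, ← zpow_add]
        congr 2
  set K := P ⊓ (MulAction.toPermHom G X).ker
  have hcount : ∀ n : ℕ, (QuotientGroup.mk '' (({a, b} : Set G) ^ n) : Set (G ⧸ K)).ncard ≤
      (QuotientGroup.mk '' (({a, b} : Set G) ^ n) : Set (G ⧸ N)).ncard * (4 * d * n + 1) := by
    intro n
    have hfin := finite_pair_pow a b n
    set W := hfin.toFinset with hW
    have hWc : (({a, b} : Set G) ^ n) = (W : Set G) := hfin.coe_toFinset.symm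
    have hWm : ∀ w ∈ W, w ∈ ({a, b} : Set G) ^ n := fun w hw => hfin.mem_toFinset.1 hw
    rw [hWc, ← Finset.coe_image, ← Finset.coe_image, Set.ncard_coe_finset, Set.ncard_coe_finset]
    have hrep : ∀ t ∈ W.image (QuotientGroup.mk : G → G ⧸ N), ∃ w ∈ W,
        (QuotientGroup.mk w : G ⧸ N) = t := fun t ht => Finset.mem_image.1 ht
    choose! rep hrepW hrepq using hrep
    have hquot : ∀ w ∈ W, ∀ w' ∈ W, (QuotientGroup.mk w : G ⧸ N) = QuotientGroup.mk w' →
        ∃ k : ℤ, ∀ x : X, w' • x = w • T ^ k • x := by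
      intro w _ w' _ h
      rw [QuotientGroup.eq] at h
      obtain ⟨k, hk⟩ := hcyc _ h
      refine ⟨k, fun x => ?_⟩
      rw [← hk x, mul_smul, smul_inv_smul]
    have hcard : (Finset.Icc (-((2 * d * n : ℕ) : ℤ)) ((2 * d * n : ℕ) : ℤ)).card =
        4 * d * n + 1 := by
      rw [Int.card_Icc]
      push_cast
      have : ((2 * d * n + 1 - -(2 * d * n) : ℤ)) = ((4 * d * n + 1 : ℕ) : ℤ) := by
        push_cast; ring
      rw [this, Int.toNat_natCast]
    rw [← hcard, ← Finset.card_product]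
    -- A class modulo K is determined by its class modulo N and the power of T separating it from a
    -- chosen representative. This exponent is at most 2dn in absolute value.
    refine Finset.card_le_card_of_forall_subsingleton
      (fun (s : G ⧸ K) (t : (G ⧸ N) × ℤ) => ∃ w ∈ W, QuotientGroup.mk w = s ∧
        QuotientGroup.mk w = t.1 ∧ w • y = T ^ t.2 • rep t.1 • y) ?_ ?_
    · intro s hs
      obtain ⟨w, hw, rfl⟩ := Finset.mem_image.1 hs
      have ht : (QuotientGroup.mk w : G ⧸ N) ∈ W.image (QuotientGroup.mk : G → G ⧸ N) :=
        Finset.mem_image_of_mem _ hw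
      obtain ⟨k, hk⟩ := hquot _ (hrepW _ ht) w hw (hrepq _ ht)
      obtain ⟨hP, hw1, hw2⟩ := hword n w (hWm w hw)
      obtain ⟨hP', hr1, hr2⟩ := hword n _ (hWm _ (hrepW _ ht))
      have hky := hk y
      rw [hcomm' _ hP'] at hky
      refine ⟨(QuotientGroup.mk w, k), Finset.mem_product.2 ⟨ht, Finset.mem_Icc.2 ⟨?_, ?_⟩⟩,
        w, hw, rfl, rfl, hky⟩
      · have h1 := hm (T ^ k) hr2
        simp only at h1
        rw [← hky, ← mul_smul, ← zpow_add] at h1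
        have := hmono.le_iff_le.1 (hw1.trans h1)
        push_cast at this ⊢
        linarith
      · have h1 := hm (T ^ k) hr1
        simp only at h1
        rw [← hky, ← mul_smul, ← zpow_add] at h1
        have := hmono.le_iff_le.1 (h1.trans hw2)
        push_cast at this ⊢
        linarith
    · rintro ⟨t, k⟩ - s₁ ⟨-, w₁, hw₁, rfl, h1, h1'⟩ s₂ ⟨-, w₂, hw₂, rfl, h2, h2'⟩
      obtain ⟨j, hj⟩ := hquot w₁ hw₁ w₂ hw₂ (h1.trans h2.symm)
      have hjy := hj y
      rw [h2', ← h1', smul_left_cancel_iff] at hjy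
      have hj0 : j = 0 := by
        apply hmono.injective
        simpa using hjy.symm
      rw [QuotientGroup.eq]
      refine Subgroup.mem_inf.2 ⟨P.mul_mem (P.inv_mem (hword n w₁ (hWm _ hw₁)).1)
        (hword n w₂ (hWm _ hw₂)).1, MonoidHom.mem_ker.2 (Equiv.ext fun x => ?_)⟩
      change (w₁⁻¹ * w₂) • x = x
      rw [mul_smul, hj x, hj0, zpow_zero, one_smul, inv_smul_smul]
  have hc' : 1 < (1 + c) / 2 := by linarith
  filter_upwards [hPN a ha b hb _ hc', eventually_linear_mul_pow_le (4 * d) (c' := (1 + c) / 2)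
    (c := c) (by linarith) (by linarith)] with n h1 h2
  refine le_trans ?_ h2
  have h3 : ((QuotientGroup.mk '' (({a, b} : Set G) ^ n) : Set (G ⧸ K)).ncard : ℝ) ≤
      (QuotientGroup.mk '' (({a, b} : Set G) ^ n) : Set (G ⧸ N)).ncard * (4 * d * n + 1) := by
    exact_mod_cast hcount n
  refine h3.trans ?_
  rw [mul_comm]
  exact mul_le_mul_of_nonneg_left h1 (by positivity)

/-- If the bottom of a chain acts through a cyclic group of translations, then the chain can be
shortened. -/
theorem IsSubexpChain.exists_shorter (hm : ∀ g : G, Monotone fun x : X => g • x)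
    {F : ℕ → Subgroup G} {m : ℕ} (hF : IsSubexpChain F (m + 2)) {T : G} (hTmem : T ∈ F (m + 1))
    (hT : ∀ x : X, x < T • x) (hcyc : ∀ f ∈ F (m + 1), ∃ k : ℤ, ∀ x : X, f • x = T ^ k • x) :
    ∃ F' : ℕ → Subgroup G, IsSubexpChain F' (m + 1) ∧ ∀ g ∈ F' (m + 1), ∀ x : X, g • x = x := by
  -- The conjugate moves points to the right and acts as a power of T, so the exponent is at least
  -- 1. Applying this to g and g⁻¹ shows that g commutes with T.
  have hle : ∀ g ∈ F m, ∀ x : X, T • x ≤ (g * T * g⁻¹) • x := by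
    intro g hg x
    obtain ⟨k, hk⟩ := hcyc _ (hF.conj_mem m (by omega) g hg T hTmem)
    have hmono := zpow_smul_strictMono hm hT x
    have h1 : x < (g * T * g⁻¹) • x := by
      rw [mul_assoc, mul_smul, lt_smul_iff_of_monotone hm, mul_smul]
      exact hT _
    rw [hk x] at h1 ⊢
    have h2 : (0 : ℤ) < k := hmono.lt_iff_lt.1 (by simpa using h1)
    simpa using hmono.monotone (Int.add_one_le_iff.2 h2)
  have hcomm : ∀ g ∈ F m, ∀ x : X, g • T • x = T • g • x := by
    intro g hg x
    refine le_antisymm ?_ ?_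
    · have h1 := hm g (hle g⁻¹ ((F m).inv_mem hg) x)
      simpa [mul_smul] using h1
    · have h1 := hle g hg (g • x)
      simpa [mul_smul] using h1
  -- The kernel of the action on X, cut down to F m, replaces both F (m + 1) and F (m + 2).
  refine ⟨fun i => if i ≤ m then F i else F m ⊓ (MulAction.toPermHom G X).ker, ⟨?_, ?_, ?_, ?_⟩, ?_⟩
  · simp [hF.zero]
  · intro i hi
    have h1 : i ≤ m := by omega
    simp only [h1, if_true]
    split_ifs with h2
    · exact hF.le i (by omega)
    · obtain rfl : i = m := by omega
      exact inf_le_left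
  · intro i hi g hg x hx
    have h1 : i ≤ m := by omega
    simp only [h1, if_true] at hg
    by_cases h2 : i + 1 ≤ m
    · simp only [h2, if_true] at hx ⊢
      exact hF.conj_mem i (by omega) g hg x hx
    · obtain rfl : i = m := by omega
      simp only [h2, if_false] at hx ⊢
      exact Subgroup.mem_inf.2 ⟨(F i).mul_mem ((F i).mul_mem hg hx.1) ((F i).inv_mem hg),
        (inferInstance : (MulAction.toPermHom G X).ker.Normal).conj_mem x hx.2 g⟩
  · intro i hi
    have h1 : i ≤ m := by omega
    simp only [h1, if_true]
    split_ifs with h2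
    · exact hF.subexp i (by omega)
    · obtain rfl : i = m := by omega
      exact (hF.subexp i (by omega)).of_commute hm hT hcyc hcomm
  · intro g hg x
    simp only [show ¬ m + 1 ≤ m by omega, if_false] at hg
    exact congrArg (fun e : Equiv.Perm X => e x) (MonoidHom.mem_ker.1 hg.2)

end Cyclic

/-! ### Induction on the length of the chain -/

section Main

universe u

variable {G : Type*} [Group G]

/-- If the bottom of the chain acts semifreely, then the claim follows from the claim for shorter
chains. -/
theorem IsSubexpChain.hasAffineDeveloping_of_semifree {X : Type u}
    [ConditionallyCompleteLinearOrder X] [MulAction G X]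
    (hm : ∀ g : G, Monotone fun x : X => g • x) {F : ℕ → Subgroup G} {m : ℕ}
    (hF : IsSubexpChain F (m + 1))
    (hsf : ∀ f ∈ F m, (∃ p : X, f • p = p) → ∀ x : X, f • x = x)
    (ih : ∀ F' : ℕ → Subgroup G, IsSubexpChain F' m → (∀ g ∈ F' m, ∀ x : X, g • x = x) →
      HasAffineDeveloping G X) : HasAffineDeveloping G X := by
  by_cases htriv : ∀ f ∈ F m, ∀ x : X, f • x = x
  · exact ih F (hF.mono (Nat.le_succ m)) htriv
  push Not at htriv
  obtain ⟨f, hf, x, hfx⟩ := htriv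
  have hm' : ∀ g : F m, Monotone fun x : X => g • x := fun g => hm g
  obtain ⟨T, hT⟩ : ∃ T : F m, ∀ x : X, x < T • x := by
    rcases exists_forall_lt_smul hm' (T := (⟨f, hf⟩ : F m))
      (fun y hy => hfx (hsf f hf ⟨y, hy⟩ x)) with h | h
    exacts [⟨_, h⟩, ⟨_, h⟩]
  obtain ⟨τ, hadd, hτ⟩ := exists_translation_of_semifree hm'
    (fun f hp x => hsf f f.2 hp x)
  let φ : Additive (F m) →+ ℝ := AddMonoidHom.mk' (fun a => τ a.toMul) fun a b => hadd _ _
  have hrange : (φ.range : Set ℝ) = Set.range τ := by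
    ext t
    exact ⟨fun ⟨a, ha⟩ => ⟨a.toMul, ha⟩, fun ⟨a, ha⟩ => ⟨Additive.ofMul a, ha⟩⟩
  rcases φ.range.dense_or_cyclic with hd | ⟨a, ha⟩
  · exact hF.hasAffineDeveloping_of_dense hm hsf hadd hτ hT (hrange ▸ hd)
  cases m with
  | zero =>
    obtain ⟨Φ, hΦm, hΦ⟩ := exists_developing hm' hadd hτ hT
    obtain ⟨⟨x, hx⟩, y, hy⟩ := developing_unbounded hadd hΦ (pos_of_developing hadd hτ hT) 0
    refine ⟨Φ, hΦm, ⟨x, y, (hy.trans hx).ne'⟩, fun g => ?_⟩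
    have hg : g ∈ F 0 := hF.zero ▸ Subgroup.mem_top g
    exact ⟨1, one_pos, τ ⟨g, hg⟩, fun x => by rw [one_mul]; exact hΦ ⟨g, hg⟩ x⟩
  | succ m =>
    have hmem : ∀ t : ℝ, t ∈ Set.range τ ↔ ∃ k : ℤ, k * a = t := by
      intro t
      rw [← hrange, SetLike.mem_coe, ha, AddSubgroup.mem_closure_singleton]
      simp
    have hpos := pos_of_developing hadd hτ hT
    obtain ⟨k₀, hk₀⟩ := (hmem (τ T)).1 ⟨T, rfl⟩
    have ha0 : a ≠ 0 := by
      rintro rfl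
      rw [mul_zero] at hk₀
      exact hpos.ne hk₀
    obtain ⟨S, hS⟩ : |a| ∈ Set.range τ := by
      rw [hmem]
      rcases abs_choice a with h | h
      · exact ⟨1, by rw [h]; simp⟩
      · exact ⟨-1, by rw [h]; simp⟩
    have hSy : ∀ x : X, x < S • x := fun x => by
      have h1 := (hτ S 1 x).not
      rw [map_one_of_additive hadd, hS, one_smul, not_le, not_le] at h1
      exact h1.1 (abs_pos.2 ha0)
    have hcyc : ∀ f ∈ F (m + 1), ∃ k : ℤ, ∀ x : X, f • x = (S : G) ^ k • x := by
      intro f hf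
      obtain ⟨k, hk⟩ := (hmem (τ ⟨f, hf⟩)).1 ⟨_, rfl⟩
      obtain ⟨k', hk'⟩ : ∃ k' : ℤ, τ (S ^ k') = τ ⟨f, hf⟩ := by
        rw [← hk]
        rcases abs_choice a with h | h
        · exact ⟨k, by rw [map_zpow_of_additive hadd, hS, h]⟩
        · exact ⟨-k, by rw [map_zpow_of_additive hadd, hS, h]; push_cast; ring⟩
      refine ⟨k', fun x => le_antisymm ?_ ?_⟩
      · exact (hτ _ _ x).1 hk'.ge
      · exact (hτ _ _ x).1 hk'.le
    obtain ⟨F', hF', htriv'⟩ := hF.exists_shorter hm S.2 hSy hcyc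
    exact ih F' hF' htriv'

/-- Affine developing maps extend from an invariant subset that is unbounded in both
directions. -/
theorem HasAffineDeveloping.of_subset {X : Type u} [LinearOrder X] [MulAction G X]
    (hm : ∀ g : G, Monotone fun x : X => g • x) (Y : SubMulAction G X)
    (hsup : ∀ x : X, ∃ y ∈ Y, y ≤ x ∧ ∀ z ∈ Y, z ≤ x → z ≤ y)
    (h : HasAffineDeveloping G Y) : HasAffineDeveloping G X := by
  obtain ⟨Φ, hΦm, ⟨a, b, hab⟩, hΦ⟩ := h
  -- r is the equivariant monotone retraction of X onto Y, and Φ ∘ r is the extension.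
  choose r hrY hrle hrmax using hsup
  have hrmono : Monotone r := fun x x' hx => hrmax x' _ (hrY x) ((hrle x).trans hx)
  have hrid : ∀ y ∈ Y, r y = y := fun y hy => le_antisymm (hrle y) (hrmax y y hy le_rfl)
  have hle : ∀ (g : G) (x : X), g • r x ≤ r (g • x) := fun g x =>
    hrmax _ _ (Y.smul_mem g (hrY x)) (hm g (hrle x))
  have hreq : ∀ (g : G) (x : X), r (g • x) = g • r x := fun g x => by
    refine le_antisymm ?_ (hle g x)
    have := hm g (hle g⁻¹ (g • x))
    simpa using this
  refine ⟨fun x => Φ ⟨r x, hrY x⟩, fun x x' hx => hΦm (hrmono hx), ⟨a, b, ?_⟩, fun g => ?_⟩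
  · simpa only [hrid a a.2, hrid b b.2] using hab
  · obtain ⟨l, hl, c, hc⟩ := hΦ g
    refine ⟨l, hl, c, fun x => ?_⟩
    rw [← hc]
    exact congrArg Φ (Subtype.ext (hreq g x))

/-- The common fixed points of those conjugates of elements of `N` that have a fixed point. -/
def commonFixed (N : Subgroup G) (X : Type*) [MulAction G X] : SubMulAction G X where
  carrier := {x | ∀ f ∈ conjugatesIn N, (∃ p : X, f • p = p) → f • x = x}
  smul_mem' g x hx f hf hp := by
    obtain ⟨p, hp⟩ := hp
    have h1 := hx (g⁻¹ * f * g⁻¹⁻¹) (conj_mem_conjugatesIn hf _)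
      ⟨g⁻¹ • p, by rw [conj_smul_eq_self_iff, inv_inv, smul_inv_smul]; exact hp⟩
    rwa [conj_smul_eq_self_iff, inv_inv] at h1

theorem csSup_mem_commonFixed {X : Type*} [ConditionallyCompleteLinearOrder X] [MulAction G X]
    (hm : ∀ g : G, Monotone fun x : X => g • x) {N : Subgroup G} {s : Set X}
    (hs : ∀ x ∈ s, x ∈ commonFixed N X) (hne : s.Nonempty) (hb : BddAbove s) :
    sSup s ∈ commonFixed N X := fun f hf hp =>
  smul_csSup_eq_self hm hne hb (fun x hx => by rwa [hs x hx f hf hp])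
    fun x hx => ⟨x, hx, (hs x hx f hf hp).ge⟩

theorem csInf_mem_commonFixed {X : Type*} [ConditionallyCompleteLinearOrder X] [MulAction G X]
    (hm : ∀ g : G, Monotone fun x : X => g • x) {N : Subgroup G} {s : Set X}
    (hs : ∀ x ∈ s, x ∈ commonFixed N X) (hne : s.Nonempty) (hb : BddBelow s) :
    sInf s ∈ commonFixed N X :=
  csSup_mem_commonFixed (X := Xᵒᵈ) (monotone_smul_orderDual hm) hs hne hb

/-- A group with a subexponential chain, acting monotonely and with a fixed-point-free element,
has an affine developing map. -/
theorem IsSubexpChain.hasAffineDeveloping {n : ℕ} {X : Type u}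
    [ConditionallyCompleteLinearOrder X] [MulAction G X]
    (hm : ∀ g : G, Monotone fun x : X => g • x) {F : ℕ → Subgroup G} (hF : IsSubexpChain F n)
    (htriv : ∀ g ∈ F n, ∀ x : X, g • x = x) {T : G} (hT : ∀ x : X, T • x ≠ x) :
    HasAffineDeveloping G X := by
  induction n generalizing X F with
  | zero => exact absurd (htriv T (hF.zero ▸ Subgroup.mem_top T) (sSup ∅)) (hT _)
  | succ m ih =>
    obtain ⟨S, hpos⟩ : ∃ S : G, ∀ x : X, x < S • x :=
      (exists_forall_lt_smul hm hT).elim (fun h => ⟨T, h⟩) fun h => ⟨T⁻¹, h⟩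
    obtain ⟨r, hr⟩ := hF.exists_common_fixed hm htriv hpos
    set Y := commonFixed (F m) X
    have hrY : r ∈ Y := hr
    let _ : Inhabited (Y : Set X) := ⟨⟨r, hrY⟩⟩
    -- Y is closed under suprema and infima taken in X. As Y need not be a real line, the induction
    -- runs over general orders.
    let _ : ConditionallyCompleteLinearOrder Y :=
      subsetConditionallyCompleteLinearOrder (Y : Set X)
        (fun {t} hne hb => csSup_mem_commonFixed hm (by rintro _ ⟨y, -, rfl⟩; exact y.2)
          (hne.image _) ((Subtype.mono_coe _).map_bddAbove hb))
        (fun {t} hne hb => csInf_mem_commonFixed hm (by rintro _ ⟨y, -, rfl⟩; exact y.2)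
          (hne.image _) ((Subtype.mono_coe _).map_bddBelow hb))
    have hmY : ∀ g : G, Monotone fun y : Y => g • y := fun g a b hab => hm g hab
    refine HasAffineDeveloping.of_subset hm Y (fun x => ?_) ?_
    · have hb : BddAbove {y | y ∈ Y ∧ y ≤ x} := ⟨x, fun y hy => hy.2⟩
      have hne : {y | y ∈ Y ∧ y ≤ x}.Nonempty := by
        obtain ⟨k, hk⟩ := exists_inv_pow_smul_lt hm hpos r x
        exact ⟨_, Y.smul_mem _ hrY, hk.le⟩
      exact ⟨_, csSup_mem_commonFixed hm (fun y hy => hy.1) hne hb, csSup_le hne fun y hy => hy.2,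
        fun z hz hzx => le_csSup hb ⟨hz, hzx⟩⟩
    · refine hF.hasAffineDeveloping_of_semifree hmY ?_ fun F' hF' htriv' =>
        ih hmY hF' htriv' fun y hy => hT y (congrArg Subtype.val hy)
      rintro f hf ⟨p, hp⟩ y
      exact Subtype.ext (y.2 f ⟨1, f, hf, by simp⟩ ⟨p, congrArg Subtype.val hp⟩)

end Main

/-! ### From developing maps to measures -/

section Measure

/-- The measure of a monotone function that is equivariant up to affine maps is
quasi-preserved. -/
theorem exists_quasiPreserved_measure {G : Type*} [Group G] (ρ : G →* (ℝ ≃ₜ ℝ))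
    (hρ : ∀ g : G, StrictMono (ρ g)) {Φ : ℝ → ℝ} (hΦm : Monotone Φ) (hne : ∃ x y, Φ x ≠ Φ y)
    (hΦ : ∀ g : G, ∃ l : ℝ, 0 < l ∧ ∃ c, ∀ x, Φ (ρ g x) = l * Φ x + c) :
    ∃ μ : Measure ℝ, μ ≠ 0 ∧ IsFiniteMeasureOnCompacts μ ∧ QuasiPreserves ρ μ := by
  refine ⟨hΦm.stieltjesFunction.measure, ?_, inferInstance, fun g => ?_⟩
  · intro h0
    obtain ⟨u, v, huv⟩ : ∃ u v, Φ u < Φ v := by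
      obtain ⟨x, y, hxy⟩ := hne
      rcases lt_or_gt_of_ne hxy with h | h
      exacts [⟨_, _, h⟩, ⟨_, _, h⟩]
    -- The left end is u - 1 because the right limit of Φ at u may exceed Φ u.
    have h1 := hΦm.stieltjesFunction.measure_Ioc (u - 1) v
    rw [h0, Measure.coe_zero, Pi.zero_apply, eq_comm, ENNReal.ofReal_eq_zero, sub_nonpos,
      hΦm.stieltjesFunction_eq, hΦm.stieltjesFunction_eq] at h1
    have h2 : Φ v ≤ Function.rightLim Φ v := hΦm.le_rightLim le_rfl
    have h3 : Function.rightLim Φ (u - 1) ≤ Φ u := hΦm.rightLim_le (by linarith)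
    linarith
  -- The push-forward measures preimages under g, so its factor is the one belonging to g⁻¹.
  · obtain ⟨l, hl, c, hc⟩ := hΦ g⁻¹
    have hlim : ∀ x, Function.rightLim Φ (ρ g⁻¹ x) = l * Function.rightLim Φ x + c := by
      intro x
      have h1 : Tendsto (ρ g⁻¹) (𝓝[>] x) (𝓝[>] (ρ g⁻¹ x)) :=
        tendsto_nhdsWithin_of_tendsto_nhds_of_eventually_within _
          ((ρ g⁻¹).continuous.continuousAt.tendsto.mono_left nhdsWithin_le_nhds)
          (eventually_nhdsWithin_of_forall fun y hy => hρ g⁻¹ hy)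
      have h2 := (hΦm.tendsto_rightLim (ρ g⁻¹ x)).comp h1
      have h3 : Tendsto (Φ ∘ ρ g⁻¹) (𝓝[>] x) (𝓝 (l * Function.rightLim Φ x + c)) := by
        refine Tendsto.congr (fun y => (hc y).symm) ?_
        exact ((hΦm.tendsto_rightLim x).const_mul l).add_const c
      exact tendsto_nhds_unique h2 h3
    have hinv : ∀ x, ρ g (ρ g⁻¹ x) = x := fun x => by
      have : (ρ g * ρ g⁻¹) x = x := by rw [← map_mul, mul_inv_cancel, map_one]; rfl
      exact this
    refine ⟨l, hl, (Measure.ext_of_Ioc' _ _ (fun a b _ => ?_) fun a b _ => ?_).symm⟩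
    · rw [Measure.smul_apply, StieltjesFunction.measure_Ioc, smul_eq_mul]
      exact ENNReal.mul_ne_top ENNReal.ofReal_ne_top ENNReal.ofReal_ne_top
    · have hpre : ρ g ⁻¹' Set.Ioc a b = Set.Ioc (ρ g⁻¹ a) (ρ g⁻¹ b) := by
        ext x
        simp only [Set.mem_preimage, Set.mem_Ioc]
        rw [← (hρ g).lt_iff_lt (a := ρ g⁻¹ a), hinv, ← (hρ g).le_iff_le (b := ρ g⁻¹ b), hinv]
      rw [Measure.map_apply (ρ g).continuous.measurable measurableSet_Ioc, hpre,
        Measure.smul_apply, StieltjesFunction.measure_Ioc, StieltjesFunction.measure_Ioc,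
        smul_eq_mul, ← ENNReal.ofReal_mul hl.le]
      simp only [hΦm.stieltjesFunction_eq, hlim]
      congr 1
      ring

end Measure

/-! ### From the growth hypothesis to subexponential chains -/

section ClassS

theorem eventually_le_pow_of_tendsto {u : ℕ → ℕ}
    (hu : Tendsto (fun n : ℕ => (u n : ℝ) ^ (1 / (n : ℝ))) atTop (𝓝 1)) {c : ℝ} (hc : 1 < c) :
    ∀ᶠ n : ℕ in atTop, (u n : ℝ) ≤ c ^ n := by
  filter_upwards [hu.eventually (ge_mem_nhds hc), eventually_gt_atTop 0] with n hn hn0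
  have h1 := pow_le_pow_left₀ (by positivity) hn n
  rwa [one_div, Real.rpow_inv_natCast_pow (by positivity) hn0.ne'] at h1

/-- Classes modulo Q of words in a and b inject into the ball of radius n in the subgroup of the
quotient generated by the images of a and b. -/
theorem SubexpMod.of_hasLocallySubexponentialGrowth {G : Type*} [Group G] {P Q : Subgroup G}
    [(Q.subgroupOf P).Normal] (h : HasLocallySubexponentialGrowth (P ⧸ Q.subgroupOf P)) :
    SubexpMod P Q := by
  classical
  intro a ha b hb c hc
  set a' : P ⧸ Q.subgroupOf P := QuotientGroup.mk ⟨a, ha⟩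
  set b' : P ⧸ Q.subgroupOf P := QuotientGroup.mk ⟨b, hb⟩
  set H := Subgroup.closure ({a', b'} : Set (P ⧸ Q.subgroupOf P)) with hH
  have haH : a' ∈ H := Subgroup.subset_closure (by simp)
  have hbH : b' ∈ H := Subgroup.subset_closure (by simp)
  have hfg : H.FG := ⟨{a', b'}, by simp [hH]⟩
  let S : Finset H := {⟨a', haH⟩, ⟨b', hbH⟩}
  have hS : Subgroup.closure (S : Set H) = ⊤ := by
    rw [← Subgroup.closure_closure_coe_preimage (k := ({a', b'} : Set (P ⧸ Q.subgroupOf P)))]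
    congr 1
    ext x
    simp [S, Subtype.ext_iff]
  have hword : ∀ n : ℕ, ∀ u ∈ ({a, b} : Set G) ^ n, ∃ hu : u ∈ P, ∃ v ∈ (S : Set H) ^ n,
      (v : P ⧸ Q.subgroupOf P) = QuotientGroup.mk ⟨u, hu⟩ := by
    intro n
    induction n with
    | zero =>
      intro u hu
      rw [pow_zero, Set.mem_one] at hu
      subst hu
      exact ⟨P.one_mem, 1, by simp, rfl⟩
    | succ n ih =>
      intro u hu
      rw [pow_succ', Set.mem_mul] at hu
      obtain ⟨g, hg, w, hw, rfl⟩ := hu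
      obtain ⟨hwP, v, hv, hvw⟩ := ih w hw
      rcases hg with rfl | rfl
      · refine ⟨P.mul_mem ha hwP, ⟨a', haH⟩ * v, ?_, ?_⟩
        · rw [pow_succ']
          exact Set.mul_mem_mul (by simp [S]) hv
        · rw [Subgroup.coe_mul, hvw]
          rfl
      · refine ⟨P.mul_mem hb hwP, ⟨b', hbH⟩ * v, ?_, ?_⟩
        · rw [pow_succ']
          exact Set.mul_mem_mul (by simp [S]) hv
        · rw [Subgroup.coe_mul, hvw]
          rfl
  filter_upwards [eventually_le_pow_of_tendsto ((h H hfg).2 S hS) hc] with n hn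
  refine le_trans ?_ hn
  have hex : ∀ s ∈ (QuotientGroup.mk '' (({a, b} : Set G) ^ n) : Set (G ⧸ Q)),
      ∃ v : H, v ∈ (S : Set H) ^ n ∧ ∃ u : G, ∃ hu : u ∈ P,
        (v : P ⧸ Q.subgroupOf P) = QuotientGroup.mk ⟨u, hu⟩ ∧ QuotientGroup.mk u = s := by
    rintro _ ⟨u, hu, rfl⟩
    obtain ⟨huP, v, hv, hvu⟩ := hword n u hu
    exact ⟨v, hv, u, huP, hvu, rfl⟩
  choose! f hfS hf using hex
  have hfin : ((insert 1 ((S : Set H) ∪ (S : Set H)⁻¹)) ^ n : Set H).Finite :=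
    Set.Finite.pow_nat ((S.finite_toSet.union S.finite_toSet.inv).insert 1) n
  have hsub : (S : Set H) ^ n ⊆ (insert 1 ((S : Set H) ∪ (S : Set H)⁻¹)) ^ n :=
    Set.pow_subset_pow_left (Set.subset_union_left.trans (Set.subset_insert _ _))
  rw [Nat.cast_le]
  refine Set.ncard_le_ncard_of_injOn f (fun s hs => hsub (hfS s hs)) ?_ hfin
  intro s hs s' hs' hss
  obtain ⟨u, hu, h1, rfl⟩ := hf s hs
  obtain ⟨u', hu', h1', rfl⟩ := hf s' hs'
  rw [hss, h1', QuotientGroup.eq] at h1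
  exact (QuotientGroup.eq.2 (Subgroup.mem_subgroupOf.1 h1)).symm

theorem exists_isSubexpChain_of_inClassS {G : Type*} [Group G] (h : InClassS G) :
    ∃ (n : ℕ) (F : ℕ → Subgroup G), IsSubexpChain F n ∧ F n = ⊥ := by
  obtain ⟨n, F, h0, hn, hF⟩ := h
  refine ⟨n, F, ⟨h0, fun i hi => (hF i hi).1, fun i hi g hg x hx => ?_, fun i hi => ?_⟩, hn⟩
  · obtain ⟨hle, hnorm, -⟩ := hF i hi
    exact hnorm.conj_mem ⟨x, hle hx⟩ hx ⟨g, hg⟩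
  · obtain ⟨hle, hnorm, hg⟩ := hF i hi
    exact SubexpMod.of_hasLocallySubexponentialGrowth hg

theorem InClassS.exists_measure {G : Type*} [Group G] (h : InClassS G) (ρ : G →* (ℝ ≃ₜ ℝ))
    (hρ : ∀ g : G, StrictMono (ρ g)) {T : G} (hT : ∀ x : ℝ, ρ T x ≠ x) :
    ∃ μ : Measure ℝ, μ ≠ 0 ∧ IsFiniteMeasureOnCompacts μ ∧ QuasiPreserves ρ μ := by
  obtain ⟨n, F, hF, hn⟩ := exists_isSubexpChain_of_inClassS h
  let _ : MulAction G ℝ :=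
    { smul := fun g x => ρ g x
      one_smul := fun x => by change ρ 1 x = x; rw [map_one]; rfl
      mul_smul := fun g g' x => by change ρ (g * g') x = ρ g (ρ g' x); rw [map_mul]; rfl }
  obtain ⟨Φ, hΦm, hne, hΦ⟩ := hF.hasAffineDeveloping (X := ℝ) (fun g => (hρ g).monotone)
    (fun g hg x => by rw [hn, Subgroup.mem_bot] at hg; rw [hg, one_smul]) hT
  exact exists_quasiPreserved_measure ρ hρ hΦm hne hΦ

end ClassS

/-! ### Solvable groups -/

section Solvable

theorem exists_exponents_of_mem_pow {K : Type*} [CommGroup K] (S : Finset K) (n : ℕ) {x : K}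
    (hx : x ∈ ((insert 1 ((S : Set K) ∪ (S : Set K)⁻¹)) ^ n : Set K)) :
    ∃ e : K → ℤ, (∀ s, |e s| ≤ n) ∧ x = ∏ s ∈ S, s ^ e s := by
  classical
  induction n generalizing x with
  | zero =>
    rw [pow_zero, Set.mem_one] at hx
    exact ⟨0, by simp, by simp [hx]⟩
  | succ n ih =>
    rw [pow_succ', Set.mem_mul] at hx
    obtain ⟨r, hr, x, hx, rfl⟩ := hx
    obtain ⟨e, he, rfl⟩ := ih hx
    have hstep : ∀ s₀ ∈ S, ∀ k : ℤ, |k| ≤ 1 → ∃ e' : K → ℤ, (∀ s, |e' s| ≤ (n + 1 : ℕ)) ∧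
        s₀ ^ k * ∏ s ∈ S, s ^ e s = ∏ s ∈ S, s ^ e' s := by
      intro s₀ hs₀ k hk
      refine ⟨fun s => (if s = s₀ then k else 0) + e s, fun s => ?_, ?_⟩
      · push_cast
        have h1 := he s
        split_ifs
        · exact (abs_add_le _ _).trans (by linarith)
        · rw [zero_add]; linarith
      · simp only [zpow_add, Finset.prod_mul_distrib]
        congr 1
        rw [Finset.prod_eq_single s₀ (fun s _ hs => by simp [hs]) fun h => absurd hs₀ h]
        simp
    rcases hr with rfl | hr | hr
    · refine ⟨e, fun s => (he s).trans (by push_cast; linarith), one_mul _⟩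
    · simpa using hstep r hr 1 (by simp)
    · simpa using hstep r⁻¹ hr (-1) (by simp)

theorem growthFunction_le_of_comm {K : Type*} [CommGroup K] (S : Finset K) (n : ℕ) :
    growthFunction S n ≤ (2 * n + 1) ^ S.card := by
  classical
  let E : Finset (S → ℤ) := Fintype.piFinset fun _ => Finset.Icc (-(n : ℤ)) n
  have hE : E.card = (2 * n + 1) ^ S.card := by
    rw [Fintype.card_piFinset, Finset.prod_const, Int.card_Icc, Finset.card_univ, Fintype.card_coe]
    congr 1
    omega
  rw [← hE, growthFunction, ← Set.ncard_coe_finset]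
  have hsub : ((insert 1 ((S : Set K) ∪ (S : Set K)⁻¹)) ^ n : Set K) ⊆
      (fun e : S → ℤ => ∏ s : S, (s : K) ^ e s) '' (E : Set (S → ℤ)) := by
    intro x hx
    obtain ⟨e, he, rfl⟩ := exists_exponents_of_mem_pow S n hx
    refine ⟨fun s => e s, ?_, ?_⟩
    · simp only [E, Finset.mem_coe, Fintype.mem_piFinset, Finset.mem_Icc]
      exact fun s => abs_le.1 (he s)
    · exact Finset.prod_coe_sort S fun s => s ^ e s
  exact (Set.ncard_le_ncard hsub (E.finite_toSet.image _)).trans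
    (Set.ncard_image_le E.finite_toSet)

theorem one_le_growthFunction {K : Type*} [Group K] (S : Finset K) (n : ℕ) :
    1 ≤ growthFunction S n := by
  have hfin : ((insert 1 ((S : Set K) ∪ (S : Set K)⁻¹)) ^ n : Set K).Finite :=
    Set.Finite.pow_nat ((S.finite_toSet.union S.finite_toSet.inv).insert 1) n
  exact (Set.ncard_pos hfin).2 ⟨1, Set.one_mem_pow (Set.mem_insert _ _)⟩

theorem tendsto_growthFunction_of_comm {K : Type*} [CommGroup K] (S : Finset K) :
    Tendsto (fun n : ℕ => (growthFunction S n : ℝ) ^ (1 / (n : ℝ))) atTop (𝓝 1) := by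
  -- The exponent is `S.card / n` rewritten in terms of 2n + 1, to match `tendsto_rpow_div_mul_add`.
  have hlim : Tendsto (fun n : ℕ => ((2 * n + 1 : ℝ)) ^ ((2 * S.card : ℝ) /
      (1 * (2 * n + 1 : ℝ) + -1))) atTop (𝓝 1) := by
    refine (tendsto_rpow_div_mul_add (2 * S.card) 1 (-1) zero_ne_one).comp ?_
    exact tendsto_atTop_add_const_right _ _
      (tendsto_natCast_atTop_atTop.const_mul_atTop (by norm_num))
  refine tendsto_of_tendsto_of_tendsto_of_le_of_le' tendsto_const_nhds hlim ?_ ?_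
  · filter_upwards with n
    exact Real.one_le_rpow (by exact_mod_cast one_le_growthFunction S n) (by positivity)
  · filter_upwards [eventually_gt_atTop 0] with n hn
    have h1 : (growthFunction S n : ℝ) ≤ (2 * n + 1 : ℝ) ^ S.card := by
      exact_mod_cast growthFunction_le_of_comm S n
    refine (Real.rpow_le_rpow (by positivity) h1 (by positivity)).trans (le_of_eq ?_)
    rw [← Real.rpow_natCast, ← Real.rpow_mul (by positivity)]
    congr 1
    have : (n : ℝ) ≠ 0 := by positivity
    field_simp
    ring

theorem hasLocallySubexponentialGrowth_of_comm {K : Type*} [Group K]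
    (h : ∀ a b : K, a * b = b * a) : HasLocallySubexponentialGrowth K := fun H hH =>
  ⟨(Group.fg_iff_subgroup_fg H).2 hH, fun S _ =>
    @tendsto_growthFunction_of_comm H
      { (inferInstance : Group H) with mul_comm := fun a b => Subtype.ext (h a b) } S⟩

theorem inClassS_of_isSolvable {G : Type*} [Group G] (h : Group.IsSolvable G) : InClassS G := by
  obtain ⟨n, hn⟩ := h.solvable
  refine ⟨n, derivedSeries G, rfl, hn, fun i _ => ⟨derivedSeries_antitone G i.le_succ,
    (derivedSeries_normal G (i + 1)).subgroupOf _, ?_⟩⟩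
  refine hasLocallySubexponentialGrowth_of_comm fun a b => ?_
  obtain ⟨a, rfl⟩ := QuotientGroup.mk_surjective a
  obtain ⟨b, rfl⟩ := QuotientGroup.mk_surjective b
  rw [← QuotientGroup.mk_mul, ← QuotientGroup.mk_mul, QuotientGroup.eq, Subgroup.mem_subgroupOf]
  -- The commutator of b⁻¹ and a⁻¹ is exactly (a * b)⁻¹ * (b * a).
  have := Subgroup.commutator_mem_commutator (inv_mem b.2) (inv_mem a.2)
  rw [← derivedSeries_succ, commutatorElement_def] at this
  simpa [mul_assoc] using this

end Solvable

theorem theoremA {G : Type*} [Group G] :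
    (Group.IsSolvable G → InClassS G) ∧
    (InClassS G →
      ∀ ρ : G →* (ℝ ≃ₜ ℝ), (∀ g : G, StrictMono (ρ g)) →
        (∃ T : G, ∀ x : ℝ, ρ T x ≠ x) →
          ∃ μ : Measure ℝ, μ ≠ 0 ∧ IsFiniteMeasureOnCompacts μ ∧ QuasiPreserves ρ μ) := by
  exact ⟨inClassS_of_isSolvable, fun h ρ hρ ⟨_, hT⟩ => h.exists_measure ρ hρ hT⟩
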